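/- Let $F$ be Thompson's group of strictly increasing piecewise linear homeomorphisms of $[0,1]$ with finitely many break points, all of them dyadic rationals, and with slopes integer powers of $2$. Let $x_0,x_1\in F$ be the generators $$x_0(t)=\begin{cases} t/2,&0\le t\le \frac12\\ t-\frac14,&\frac12\le t\le\frac34\\ 2t-1,&\frac34\le t\le 1\end{cases}\qquad x_1(t)=\begin{cases} t,&0\le t\le\frac12\\ \frac t2+\frac14,&\frac12\le t\le\frac34\\ t-\frac18,&\frac34\le t\le\frac78\\ 2t-1,&\frac78\le t\le1.\end{cases}$$ For $q\in[0,1]$ let $\Gamma_q$ be the pointed Schreier graph of the action of $F$ on the orbit of $q$: its vertices are the points of the orbit, there is an edge labeled $x_i$ from $y$ to $x_i(y)$ for all $y$ and $i\in\{0,1\}$, and $q$ is the base vertex. Consider the space of connected pointed oriented graphs with edges labeled by $x_0,x_1$, in which each vertex has exactly one outgoing and one incoming edge of each label, up to isomorphism of pointed labeled graphs. The distance of two graphs is $2^{-n}$, where $n$ is the largest integer such that the balls of radius $n$ around the base vertices are isomorphic as pointed labeled graphs (the distance is $0$ if all these balls are isomorphic, and $n=-1$ if even the balls of radius $0$ are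 not). Let $\mathcal C=\{\Gamma_q : q \text{ a dyadic rational},\ 0<q<1\}$. For an infinite word $w=w_0w_1w_2\ldots$ over $\{0,1\}$ let $T_w$ be the following labeled graph. Its grey vertices form a binary tree without root, in which every grey vertex has a $0$-child, a $1$-child and a parent: there is an infinite upward path $s_0,s_1,s_2,\ldots$ such that $s_k$ is the $w_k$-child of $s_{k+1}$ (so the path turns left or right at each level as the letter of $w$ is $0$ or $1$), and full binary trees hang below $s_0$ and below the other child of each $s_{k+1}$. Each grey vertex $g$ lies on a line of vertices $(g,j)$, $j\in\mathbb Z$, with $(g,0)=g$, and these are all the vertices of $T_w$. The edge labeled $x_0$ goes from $(g,j)$ to $(g,j+1)$. The edge labeled $x_1$ that starts at $(g,j)$ is a loop if $j\ge1$, ends at the $0$-child of $g$ if $j=0$, ends at the $1$-child of $g$ if $j=-1$, and ends at $(g,j+1)$ if $j\le-2$. For $n\ge1$ let $\tilde\Gamma_{1^n0w}$ and $\tilde\Gamma_{0^n1w}$ be the graph $T_w$ with base vertex $(s_0,1-n)$ and $(s_0,n)$, respectively. Let $\tilde\Gamma_{0^\infty}$ and $\tilde\Gamma_{1^\infty}$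 be the graphs with vertex set $\mathbb Z$, base vertex $0$, and edges labeled $x_0$ from $j$ to $j+1$ for all $j$; the edges labeled $x_1$ are a loop at each $j$ in $\tilde\Gamma_{0^\infty}$, and go from $j$ to $j+1$ for all $j$ in $\tilde\Gamma_{1^\infty}$. **Proposition.** Up to isomorphism of pointed labeled graphs, the closure $\overline{\mathcal C}$ consists exactly of the following graphs: A. the Schreier graph of the action of $F$ on the orbit of $\frac12$ with any vertex as base vertex; B. the graphs $\tilde\Gamma_{1^n0w}$ and $\tilde\Gamma_{0^n1w}$ for all $n\ge1$ and $w\in\{0,1\}^{\mathbb N}$; C. the two graphs $\tilde\Gamma_{0^\infty}$ and $\tilde\Gamma_{1^\infty}$. Moreover, if $\xi\ne\eta$ are infinite words over $\{0,1\}$, then $\tilde\Gamma_\xi$ and $\tilde\Gamma_\eta$ are not isomorphic as pointed labeled graphs. -/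

import Mathlib

namespace ThompsonSchreier

open Set Filter Topology
open scoped unitInterval

/-! ### Dyadic rationals and Thompson's group `F` -/

/-- `t` is a dyadic rational number. -/
def IsDyadic (t : ℝ) : Prop := ∃ (a : ℤ) (n : ℕ), t = a / 2 ^ n

theorem IsDyadic.add {s t : ℝ} (hs : IsDyadic s) (ht : IsDyadic t) : IsDyadic (s + t) := by
  obtain ⟨a, n, rfl⟩ := hs
  obtain ⟨b, m, rfl⟩ := ht
  refine ⟨a * 2 ^ m + b * 2 ^ n, n + m, ?_⟩
  push_cast
  field_simp
  ring

theorem IsDyadic.neg {t : ℝ} (ht : IsDyadic t) : IsDyadic (-t) := by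
  obtain ⟨b, m, rfl⟩ := ht
  exact ⟨-b, m, by push_cast; ring⟩

theorem IsDyadic.sub {s t : ℝ} (hs : IsDyadic s) (ht : IsDyadic t) : IsDyadic (s - t) := by
  rw [sub_eq_add_neg]
  exact hs.add ht.neg

theorem IsDyadic.zpow_mul (k : ℤ) {t : ℝ} (ht : IsDyadic t) : IsDyadic (2 ^ k * t) := by
  obtain ⟨b, m, rfl⟩ := ht
  rcases Int.eq_nat_or_neg k with ⟨n, rfl | rfl⟩
  · exact ⟨b * 2 ^ n, m, by push_cast; rw [zpow_natCast]; ring⟩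
  · exact ⟨b, n + m, by rw [zpow_neg, zpow_natCast, pow_add]; field_simp⟩

theorem isDyadic_zpow_mul_iff (k : ℤ) {t : ℝ} : IsDyadic (2 ^ k * t) ↔ IsDyadic t := by
  refine ⟨fun h => ?_, IsDyadic.zpow_mul k⟩
  have := h.zpow_mul (-k)
  rwa [← mul_assoc, ← zpow_add₀ (by norm_num : (2 : ℝ) ≠ 0), neg_add_cancel, zpow_zero,
    one_mul] at this

/-- A strictly increasing bijection `f` of `[0,1]` (such an `f` is automatically a homeomorphism)
is piecewise linear, with slopes integer powers of `2` and with finitely many break points, all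
of them dyadic: outside a finite set `D` of dyadic rationals, `f` is locally of the form
`s ↦ 2 ^ k * s + c`. -/
def IsDyadicPL (f : I ≃o I) : Prop :=
  ∃ D : Finset I, (∀ d ∈ D, IsDyadic d) ∧
    ∀ t ∉ D, ∃ (k : ℤ) (c : ℝ), ∀ᶠ s in 𝓝 t, (f s : ℝ) = 2 ^ k * (s : ℝ) + c

theorem hasDerivAt_extend {f : I ≃o I} {t : ℝ} (ht : t ∈ Ioo (0 : ℝ) 1) {k : ℤ} {c : ℝ}
    (h : ∀ᶠ s in 𝓝 (⟨t, Ioo_subset_Icc_self ht⟩ : I), (f s : ℝ) = 2 ^ k * (s : ℝ) + c) :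
    HasDerivAt (fun s : ℝ => (f (projIcc 0 1 zero_le_one s) : ℝ)) (2 ^ k) t := by
  have h1 : projIcc (0 : ℝ) 1 zero_le_one t = ⟨t, Ioo_subset_Icc_self ht⟩ :=
    projIcc_of_mem _ _
  have h2 : ∀ᶠ s in 𝓝 t, (f (projIcc 0 1 zero_le_one s) : ℝ)
      = 2 ^ k * ((projIcc 0 1 zero_le_one s : I) : ℝ) + c := by
    have hc : Tendsto (projIcc (0 : ℝ) 1 zero_le_one) (𝓝 t)
        (𝓝 (⟨t, Ioo_subset_Icc_self ht⟩ : I)) := by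
      rw [← h1]; exact continuous_projIcc.continuousAt
    exact hc.eventually h
  have h3 : (fun s : ℝ => (f (projIcc 0 1 zero_le_one s) : ℝ)) =ᶠ[𝓝 t]
      fun s => 2 ^ k * s + c := by
    filter_upwards [h2, isOpen_Ioo.mem_nhds ht] with s hs hs'
    rw [hs, projIcc_of_mem _ (Ioo_subset_Icc_self hs')]
  refine HasDerivAt.congr_of_eventuallyEq ?_ h3
  simpa using ((hasDerivAt_id t).const_mul ((2 : ℝ) ^ k)).add_const c

theorem IsDyadicPL.isDyadic_iff {f : I ≃o I} (hf : IsDyadicPL f) (t : I) :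
    IsDyadic (f t) ↔ IsDyadic t := by
  obtain ⟨D, hD, hloc⟩ := hf
  have zero_dy : IsDyadic 0 := ⟨0, 0, by simp⟩
  have key : ∀ (n : ℕ) (t : I), (D.filter (· < t)).card = n →
      (IsDyadic (f t) ↔ IsDyadic t) := by
    intro n
    induction n using Nat.strong_induction_on with
    | _ n ih =>
      intro t hn
      rcases eq_or_lt_of_le (unitInterval.nonneg' : (0 : I) ≤ t) with h0 | h0
      · subst h0
        have : f 0 = 0 := f.map_bot
        rw [this]
      -- the largest break point below `t`, or `0`
      obtain ⟨d, hdt, hd, hfd, hmax⟩ : ∃ d : I, d < t ∧ IsDyadic d ∧ IsDyadic (f d) ∧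
          ∀ s, d < s → s < t → s ∉ D := by
        by_cases hne : (D.filter (· < t)).Nonempty
        · obtain ⟨d, hdm, hdmax⟩ := Finset.exists_max_image _ id hne
          rw [Finset.mem_filter] at hdm
          have hlt : (D.filter (· < d)).card < n := by
            rw [← hn]
            apply Finset.card_lt_card
            refine Finset.ssubset_iff_subset_ne.2 ⟨fun x hx => ?_, fun he => ?_⟩
            · rw [Finset.mem_filter] at hx ⊢
              exact ⟨hx.1, hx.2.trans hdm.2⟩
            · have : d ∈ D.filter (· < d) := by
                rw [he, Finset.mem_filter]; exact hdm
              simp at this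
          refine ⟨d, hdm.2, hD d hdm.1, (ih _ hlt d rfl).2 (hD d hdm.1), fun s h1 h2 h3 => ?_⟩
          exact absurd (hdmax s (Finset.mem_filter.2 ⟨h3, h2⟩)) (not_le.2 h1)
        · refine ⟨0, h0, zero_dy, ?_, fun s _ h2 h3 => ?_⟩
          · have : f 0 = 0 := f.map_bot
            rw [this]; exact zero_dy
          · exact hne ⟨s, Finset.mem_filter.2 ⟨h3, h2⟩⟩
      have hIoo : ∀ s ∈ Ioo (d : ℝ) t, s ∈ Ioo (0 : ℝ) 1 := fun s hs =>
        ⟨lt_of_le_of_lt d.2.1 hs.1, lt_of_lt_of_le hs.2 t.2.2⟩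
      have hex : ∀ s ∈ Ioo (d : ℝ) t, ∃ k : ℤ,
          HasDerivAt (fun s : ℝ => (f (projIcc 0 1 zero_le_one s) : ℝ)) (2 ^ k) s := by
        intro s hs
        obtain ⟨k, c, h⟩ := hloc ⟨s, Ioo_subset_Icc_self (hIoo s hs)⟩ (hmax _ hs.1 hs.2)
        exact ⟨k, hasDerivAt_extend (hIoo s hs) h⟩
      have hcont : Continuous (fun s : ℝ => (f (projIcc 0 1 zero_le_one s) : ℝ)) :=
        continuous_subtype_val.comp (f.continuous.comp continuous_projIcc)
      obtain ⟨m, hm, hslope⟩ := exists_deriv_eq_slope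
        (fun s : ℝ => (f (projIcc 0 1 zero_le_one s) : ℝ)) hdt hcont.continuousOn
        (fun s hs => (hex s hs).choose_spec.differentiableAt.differentiableWithinAt)
      obtain ⟨k, hk⟩ := hex m hm
      rw [hk.deriv] at hslope
      simp only [projIcc_val] at hslope
      have hpos : (t : ℝ) - d ≠ 0 := sub_ne_zero.2 (ne_of_gt hdt)
      have heq : (f t : ℝ) = f d + 2 ^ k * ((t : ℝ) - d) := by
        rw [hslope]; field_simp; ring
      constructor
      · intro h
        have h1 : IsDyadic ((2 : ℝ) ^ k * ((t : ℝ) - d)) := by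
          have := h.sub hfd
          rw [heq] at this
          simpa using this
        have := ((isDyadic_zpow_mul_iff k).1 h1).add hd
        simpa using this
      · intro h
        rw [heq]
        exact hfd.add ((h.sub hd).zpow_mul k)
  exact key _ t rfl

/-- Thompson's group `F`, with composition of maps as group operation. -/
def thompsonF : Subgroup (I ≃o I) where
  carrier := {f | IsDyadicPL f}
  one_mem' := ⟨∅, by simp, fun t _ => ⟨0, 0, by simp⟩⟩
  mul_mem' := by
    intro f g hf hg
    have hg' := hg
    obtain ⟨D, hD, hf⟩ := hf
    obtain ⟨E, hE, hg⟩ := hg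
    classical
    refine ⟨E ∪ D.image g.symm, fun d hd => ?_, fun t ht => ?_⟩
    · rcases Finset.mem_union.1 hd with h | h
      · exact hE d h
      · obtain ⟨e, he, rfl⟩ := Finset.mem_image.1 h
        rw [← hg'.isDyadic_iff, OrderIso.apply_symm_apply]
        exact hD e he
    · rw [Finset.mem_union, not_or] at ht
      obtain ⟨k, c, h⟩ := hg t ht.1
      obtain ⟨l, e, h'⟩ := hf (g t) (fun h => ht.2 (Finset.mem_image.2 ⟨_, h, by simp⟩))
      refine ⟨l + k, 2 ^ l * c + e, ?_⟩
      filter_upwards [h, g.continuous.continuousAt.eventually h'] with s h1 h2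
      change (f (g s) : ℝ) = _
      rw [h2, h1, zpow_add₀ (by norm_num)]
      ring
  inv_mem' := by
    intro f hf
    have hf' := hf
    obtain ⟨D, hD, hf⟩ := hf
    classical
    refine ⟨D.image f, fun d hd => ?_, fun t ht => ?_⟩
    · obtain ⟨e, he, rfl⟩ := Finset.mem_image.1 hd
      exact (hf'.isDyadic_iff e).2 (hD e he)
    · obtain ⟨k, c, h⟩ := hf (f.symm t) (fun h => ht (Finset.mem_image.2 ⟨_, h, by simp⟩))
      refine ⟨-k, -(2 ^ (-k) * c), ?_⟩
      filter_upwards [f.symm.continuous.continuousAt.eventually h] with s h1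
      change (f.symm s : ℝ) = _
      rw [OrderIso.apply_symm_apply] at h1
      rw [h1, mul_add, ← mul_assoc, ← zpow_add₀ (by norm_num : (2 : ℝ) ≠ 0)]
      simp

/-! ### The generators `x₀` and `x₁` -/

/-- The formula of `x₀` on `[0,1]`. -/
noncomputable def x0Fun (t : ℝ) : ℝ :=
  if t ≤ 1 / 2 then t / 2 else if t ≤ 3 / 4 then t - 1 / 4 else 2 * t - 1

/-- The formula of `x₁` on `[0,1]`. -/
noncomputable def x1Fun (t : ℝ) : ℝ :=
  if t ≤ 1 / 2 then t else if t ≤ 3 / 4 then t / 2 + 1 / 4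
  else if t ≤ 7 / 8 then t - 1 / 8 else 2 * t - 1

/-- The inverse of `x0Fun`. -/
noncomputable def x0Inv (t : ℝ) : ℝ :=
  if t ≤ 1 / 4 then 2 * t else if t ≤ 1 / 2 then t + 1 / 4 else (t + 1) / 2

/-- The inverse of `x1Fun`. -/
noncomputable def x1Inv (t : ℝ) : ℝ :=
  if t ≤ 1 / 2 then t else if t ≤ 5 / 8 then 2 * t - 1 / 2
  else if t ≤ 3 / 4 then t + 1 / 8 else (t + 1) / 2

/-- The homeomorphism `x₀` of `[0,1]`. -/
noncomputable def x0 : I ≃o I where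
  toFun t := ⟨x0Fun t, by
    obtain ⟨t, h0, h1⟩ := t
    simp only [x0Fun, mem_Icc]
    split_ifs <;> constructor <;> linarith⟩
  invFun t := ⟨x0Inv t, by
    obtain ⟨t, h0, h1⟩ := t
    simp only [x0Inv, mem_Icc]
    split_ifs <;> constructor <;> linarith⟩
  left_inv t := by
    apply Subtype.ext
    simp only [x0Fun, x0Inv]
    split_ifs <;> linarith
  right_inv t := by
    apply Subtype.ext
    simp only [x0Fun, x0Inv]
    split_ifs <;> linarith
  map_rel_iff' := by
    intro s t
    simp only [Equiv.coe_fn_mk, ← Subtype.coe_le_coe, x0Fun]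
    split_ifs <;> constructor <;> intro h <;> linarith

/-- The homeomorphism `x₁` of `[0,1]`. -/
noncomputable def x1 : I ≃o I where
  toFun t := ⟨x1Fun t, by
    obtain ⟨t, h0, h1⟩ := t
    simp only [x1Fun, mem_Icc]
    split_ifs <;> constructor <;> linarith⟩
  invFun t := ⟨x1Inv t, by
    obtain ⟨t, h0, h1⟩ := t
    simp only [x1Inv, mem_Icc]
    split_ifs <;> constructor <;> linarith⟩
  left_inv t := by
    apply Subtype.ext
    simp only [x1Fun, x1Inv]
    split_ifs <;> linarith
  right_inv t := by
    apply Subtype.ext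
    simp only [x1Fun, x1Inv]
    split_ifs <;> linarith
  map_rel_iff' := by
    intro s t
    simp only [Equiv.coe_fn_mk, ← Subtype.coe_le_coe, x1Fun]
    split_ifs <;> constructor <;> intro h <;> linarith

theorem eventually_lt_coe {t : I} {a : ℝ} (h : (t : ℝ) < a) : ∀ᶠ s : I in 𝓝 t, (s : ℝ) < a :=
  continuous_subtype_val.continuousAt.eventually (Iio_mem_nhds h)

theorem eventually_gt_coe {t : I} {a : ℝ} (h : a < (t : ℝ)) : ∀ᶠ s : I in 𝓝 t, a < (s : ℝ) :=
  continuous_subtype_val.continuousAt.eventually (Ioi_mem_nhds h)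

theorem x0_isDyadicPL : IsDyadicPL x0 := by
  classical
  refine ⟨{⟨1 / 2, by norm_num, by norm_num⟩, ⟨3 / 4, by norm_num, by norm_num⟩}, ?_, ?_⟩
  · intro d hd
    simp only [Finset.mem_insert, Finset.mem_singleton] at hd
    rcases hd with rfl | rfl
    · exact ⟨1, 1, by norm_num⟩
    · exact ⟨3, 2, by norm_num⟩
  · intro t ht
    simp only [Finset.mem_insert, Finset.mem_singleton, Subtype.ext_iff, not_or] at ht
    have hx : ∀ s : I, (x0 s : ℝ) = x0Fun s := fun _ => rfl
    rcases lt_or_gt_of_ne ht.1 with h | h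
    · refine ⟨-1, 0, ?_⟩
      filter_upwards [eventually_lt_coe h] with s hs
      rw [hx, x0Fun, if_pos hs.le]
      norm_num; ring
    rcases lt_or_gt_of_ne ht.2 with h' | h'
    · refine ⟨0, -1 / 4, ?_⟩
      filter_upwards [eventually_gt_coe h, eventually_lt_coe h'] with s hs hs'
      rw [hx, x0Fun, if_neg hs.not_ge, if_pos hs'.le]
      norm_num; ring
    · refine ⟨1, -1, ?_⟩
      filter_upwards [eventually_gt_coe h, eventually_gt_coe h'] with s hs hs'
      rw [hx, x0Fun, if_neg hs.not_ge, if_neg hs'.not_ge]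
      norm_num; ring

theorem x1_isDyadicPL : IsDyadicPL x1 := by
  classical
  refine ⟨{⟨1 / 2, by norm_num, by norm_num⟩, ⟨3 / 4, by norm_num, by norm_num⟩,
    ⟨7 / 8, by norm_num, by norm_num⟩}, ?_, ?_⟩
  · intro d hd
    simp only [Finset.mem_insert, Finset.mem_singleton] at hd
    rcases hd with rfl | rfl | rfl
    · exact ⟨1, 1, by norm_num⟩
    · exact ⟨3, 2, by norm_num⟩
    · exact ⟨7, 3, by norm_num⟩
  · intro t ht
    simp only [Finset.mem_insert, Finset.mem_singleton, Subtype.ext_iff, not_or] at ht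
    have hx : ∀ s : I, (x1 s : ℝ) = x1Fun s := fun _ => rfl
    rcases lt_or_gt_of_ne ht.1 with h | h
    · refine ⟨0, 0, ?_⟩
      filter_upwards [eventually_lt_coe h] with s hs
      rw [hx, x1Fun, if_pos hs.le]
      norm_num
    rcases lt_or_gt_of_ne ht.2.1 with h' | h'
    · refine ⟨-1, 1 / 4, ?_⟩
      filter_upwards [eventually_gt_coe h, eventually_lt_coe h'] with s hs hs'
      rw [hx, x1Fun, if_neg hs.not_ge, if_pos hs'.le]
      norm_num; ring
    rcases lt_or_gt_of_ne ht.2.2 with h'' | h''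
    · refine ⟨0, -1 / 8, ?_⟩
      filter_upwards [eventually_gt_coe h, eventually_gt_coe h', eventually_lt_coe h'']
        with s hs hs' hs''
      rw [hx, x1Fun, if_neg hs.not_ge, if_neg hs'.not_ge, if_pos hs''.le]
      norm_num; ring
    · refine ⟨1, -1, ?_⟩
      filter_upwards [eventually_gt_coe h, eventually_gt_coe h', eventually_gt_coe h'']
        with s hs hs' hs''
      rw [hx, x1Fun, if_neg hs.not_ge, if_neg hs'.not_ge, if_neg hs''.not_ge]
      norm_num; ring

/-- The generating pair `x₀, x₁` of `F`, indexed by the labels `0, 1`. -/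
noncomputable def gen : Fin 2 → thompsonF :=
  ![⟨x0, x0_isDyadicPL⟩, ⟨x1, x1_isDyadicPL⟩]

/-- The dyadic rational numbers of the open interval `(0,1)`, as points of `[0,1]`. -/
def DyadicPoint : Type := {q : I // IsDyadic q ∧ 0 < (q : ℝ) ∧ (q : ℝ) < 1}

/-- The point `1/2`. -/
noncomputable def DyadicPoint.half : DyadicPoint :=
  ⟨⟨1 / 2, by norm_num, by norm_num⟩, ⟨1, 1, by norm_num⟩, by norm_num, by norm_num⟩


theorem gen_zero_smul (t : I) : ((gen 0 • t : I) : ℝ) = x0Fun t := rfl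

theorem gen_one_smul (t : I) : ((gen 1 • t : I) : ℝ) = x1Fun t := rfl

theorem gen_zero_inv_smul (t : I) : (((gen 0)⁻¹ • t : I) : ℝ) = x0Inv t := rfl

theorem gen_one_inv_smul (t : I) : (((gen 1)⁻¹ • t : I) : ℝ) = x1Inv t := rfl

theorem exists_smul_eq_half (n : ℕ) : ∀ (t : I) (a : ℤ), (t : ℝ) * 2 ^ n = a → 0 < (t : ℝ) →
    (t : ℝ) < 1 → ∃ g ∈ Subgroup.closure (Set.range gen), ((g • t : I) : ℝ) = 1 / 2 := by
  have mem (i : Fin 2) : gen i ∈ Subgroup.closure (Set.range gen) :=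
    Subgroup.subset_closure ⟨i, rfl⟩
  -- it suffices to solve the problem for some image of `t`
  have step : ∀ (t : I) (h : thompsonF), h ∈ Subgroup.closure (Set.range gen) →
      (∃ g ∈ Subgroup.closure (Set.range gen), ((g • (h • t) : I) : ℝ) = 1 / 2) →
      ∃ g ∈ Subgroup.closure (Set.range gen), ((g • t : I) : ℝ) = 1 / 2 := by
    rintro t h hh ⟨g, hg, h'⟩
    exact ⟨g * h, mul_mem hg hh, by rw [mul_smul, h']⟩
  induction n with
  | zero =>
    intro t a h h0 h1
    simp only [pow_zero, mul_one] at h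
    rw [h] at h0 h1
    norm_cast at h0 h1
    omega
  | succ n ih =>
    -- the case `1/2 < t < 3/4`
    have mid : ∀ (t : I) (a : ℤ), (t : ℝ) * 2 ^ (n + 1) = a → 1 / 2 < (t : ℝ) →
        (t : ℝ) < 3 / 4 → ∃ g ∈ Subgroup.closure (Set.range gen),
          ((g • t : I) : ℝ) = 1 / 2 := by
      intro t a h h0 h1
      obtain _ | n := n
      · norm_num at h
        have h2 : (1 : ℝ) < a := by linarith
        have h3 : (a : ℝ) < 2 := by linarith
        norm_cast at h2 h3
        omega
      rcases le_or_gt (t : ℝ) (5 / 8) with h5 | h5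
      · apply step t _ (inv_mem (mem 1))
        have e : (((gen 1)⁻¹ • t : I) : ℝ) = 2 * t - 1 / 2 := by
          rw [gen_one_inv_smul, x1Inv, if_neg (by linarith), if_pos h5]
        refine ih _ (a - 2 ^ n) ?_ (by rw [e]; linarith) (by rw [e]; linarith)
        rw [e]; push_cast; rw [← h]; ring
      · obtain _ | n := n
        · norm_num at h
          have h2 : (2 : ℝ) < a := by linarith
          have h3 : (a : ℝ) < 3 := by linarith
          norm_cast at h2 h3
          omega
        apply step t _ (inv_mem (mem 1))
        apply step _ _ (mem 0)
        have e : (((gen 1)⁻¹ • t : I) : ℝ) = t + 1 / 8 := by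
          rw [gen_one_inv_smul, x1Inv, if_neg (by linarith), if_neg (by linarith),
            if_pos h1.le]
        have e' : ((gen 0 • ((gen 1)⁻¹ • t) : I) : ℝ) = 2 * t - 3 / 4 := by
          rw [gen_zero_smul, e, x0Fun, if_neg (by linarith), if_neg (by linarith)]
          ring
        refine ih _ (a - 3 * 2 ^ n) ?_ (by rw [e']; linarith) (by rw [e']; linarith)
        rw [e']; push_cast; rw [← h]; ring
    intro t a h h0 h1
    rcases le_or_gt (t : ℝ) (1 / 4) with h4 | h4
    · apply step t _ (inv_mem (mem 0))
      have e : (((gen 0)⁻¹ • t : I) : ℝ) = 2 * t := by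
        rw [gen_zero_inv_smul, x0Inv, if_pos h4]
      refine ih _ a ?_ (by rw [e]; linarith) (by rw [e]; linarith)
      rw [e, ← h]; ring
    rcases lt_trichotomy (t : ℝ) (1 / 2) with h2 | h2 | h2
    · obtain _ | n := n
      · norm_num at h
        have h2 : (0 : ℝ) < a := by linarith
        have h3 : (a : ℝ) < 1 := by linarith
        norm_cast at h2 h3
        omega
      apply step t _ (inv_mem (mem 0))
      have e : (((gen 0)⁻¹ • t : I) : ℝ) = t + 1 / 4 := by
        rw [gen_zero_inv_smul, x0Inv, if_neg (by linarith), if_pos h2.le]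
      refine mid _ (a + 2 ^ n) ?_ (by rw [e]; linarith) (by rw [e]; linarith)
      rw [e]; push_cast; rw [← h]; ring
    · exact ⟨1, one_mem _, by rw [one_smul, h2]⟩
    rcases lt_or_ge (t : ℝ) (3 / 4) with h3 | h3
    · exact mid t a h h2 h3
    · apply step t _ (mem 0)
      have e : ((gen 0 • t : I) : ℝ) = 2 * t - 1 := by
        rw [gen_zero_smul, x0Fun, if_neg (by linarith)]
        split_ifs <;> linarith
      refine ih _ (a - 2 ^ n) ?_ (by rw [e]; linarith) (by rw [e]; linarith)
      rw [e]; push_cast; rw [← h]; ring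

theorem DyadicPoint.exists_smul_eq (q r : DyadicPoint) :
    ∃ g ∈ Subgroup.closure (Set.range gen), g • q.1 = r.1 := by
  obtain ⟨⟨a, n, ha⟩, hq0, hq1⟩ := q.2
  obtain ⟨⟨b, m, hb⟩, hr0, hr1⟩ := r.2
  obtain ⟨g, hg, hgq⟩ := exists_smul_eq_half n q.1 a (by rw [ha]; field_simp) hq0 hq1
  obtain ⟨h, hh, hhr⟩ := exists_smul_eq_half m r.1 b (by rw [hb]; field_simp) hr0 hr1
  refine ⟨h⁻¹ * g, mul_mem (inv_mem hh) hg, ?_⟩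
  rw [mul_smul, inv_smul_eq_iff]
  exact Subtype.ext (hgq.trans hhr.symm)

theorem smul_zero_eq (f : thompsonF) : f • (0 : I) = 0 := f.1.map_bot

theorem smul_one_eq (f : thompsonF) : f • (1 : I) = 1 := f.1.map_top

/-- `F` maps dyadic rationals in `(0,1)` to dyadic rationals in `(0,1)`. -/
def DyadicPoint.map (f : thompsonF) (q : DyadicPoint) : DyadicPoint :=
  ⟨f • q.1, (IsDyadicPL.isDyadic_iff f.2 q.1).2 q.2.1, by
    have h : f.1 0 < f.1 q.1 := f.1.strictMono q.2.2.1
    rwa [show f.1 0 = 0 from smul_zero_eq f] at h, by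
    have h : f.1 q.1 < f.1 1 := f.1.strictMono q.2.2.2
    rwa [show f.1 1 = 1 from smul_one_eq f] at h⟩

/-! ### Marked pointed graphs -/

/-- A connected regular marked pointed graph: an oriented graph with a base vertex whose edges
are labeled by `0` (for `x₀`) and `1` (for `x₁`), such that every vertex is the initial vertex of
exactly one edge and the terminal vertex of exactly one edge of each label.
`E s x y` means that there is an edge labeled by `s` from `x` to `y`. -/
structure PGraph where
  /-- vertices -/
  V : Type
  /-- labeled oriented edges -/
  E : Fin 2 → V → V → Prop
  /-- the selected vertex -/
  base : V
  out_unique : ∀ s x, ∃! y, E s x y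
  in_unique : ∀ s y, ∃! x, E s x y
  connected : ∀ v, Relation.EqvGen (fun x y => ∃ s, E s x y) base v

namespace PGraph

/-- Isomorphism of marked pointed graphs. -/
def Iso (Γ Δ : PGraph) : Prop :=
  ∃ e : Γ.V ≃ Δ.V, e Γ.base = Δ.base ∧ ∀ s x y, Γ.E s x y ↔ Δ.E s (e x) (e y)

/-- The same graph with another base vertex `v`. -/
def rebase (Γ : PGraph) (v : Γ.V) : PGraph :=
  { Γ with base := v, connected := fun u => ((Γ.connected v).symm _ _).trans _ _ _ (Γ.connected u) }

/-- The vertices of the ball of radius `n` around the base vertex, for the path metric of the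
underlying non-oriented graph. -/
def ball (Γ : PGraph) : ℕ → Set Γ.V
  | 0 => {Γ.base}
  | n + 1 => Γ.ball n ∪ {y | ∃ x ∈ Γ.ball n, ∃ s, Γ.E s x y ∨ Γ.E s y x}

/-- The balls of radius `n` around the base vertices (as induced subgraphs) are isomorphic as
marked pointed graphs. -/
def BallIso (n : ℕ) (Γ Δ : PGraph) : Prop :=
  ∃ f : Γ.V → Δ.V, BijOn f (Γ.ball n) (Δ.ball n) ∧ f Γ.base = Δ.base ∧
    ∀ s, ∀ x ∈ Γ.ball n, ∀ y ∈ Γ.ball n, Γ.E s x y ↔ Δ.E s (f x) (f y)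

theorem ball_mono (Γ : PGraph) : Monotone Γ.ball :=
  monotone_nat_of_le_succ fun _ => subset_union_left

theorem base_mem_ball (Γ : PGraph) (n : ℕ) : Γ.base ∈ Γ.ball n :=
  Γ.ball_mono (Nat.zero_le n) rfl

theorem BallIso.refl (n : ℕ) (Γ : PGraph) : BallIso n Γ Γ :=
  ⟨id, bijOn_id _, rfl, fun _ _ _ _ _ => Iff.rfl⟩

theorem BallIso.symm {n : ℕ} {Γ Δ : PGraph} (h : BallIso n Γ Δ) : BallIso n Δ Γ := by
  obtain ⟨f, hf, hb, hE⟩ := h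
  have : Nonempty Γ.V := ⟨Γ.base⟩
  have hinv := hf.invOn_invFunOn
  have hbij : BijOn (Function.invFunOn f (Γ.ball n)) (Δ.ball n) (Γ.ball n) :=
    hf.symm hinv.symm
  refine ⟨Function.invFunOn f (Γ.ball n), hbij, ?_, fun s x hx y hy => ?_⟩
  · rw [← hb]
    exact hinv.1 (Γ.base_mem_ball n)
  · rw [hE s _ (hbij.mapsTo hx) _ (hbij.mapsTo hy), hinv.2 hx, hinv.2 hy]

theorem BallIso.trans {n : ℕ} {Γ Δ Θ : PGraph} (h : BallIso n Γ Δ) (h' : BallIso n Δ Θ) :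
    BallIso n Γ Θ := by
  obtain ⟨f, hf, hb, hE⟩ := h
  obtain ⟨g, hg, hb', hE'⟩ := h'
  refine ⟨g ∘ f, hg.comp hf, by simp [hb, hb'], fun s x hx y hy => ?_⟩
  rw [hE s x hx y hy, hE' s _ (hf.mapsTo hx) _ (hf.mapsTo hy)]
  rfl

theorem BallIso.mono {m n : ℕ} (hmn : m ≤ n) {Γ Δ : PGraph} (h : BallIso n Γ Δ) :
    BallIso m Γ Δ := by
  obtain ⟨f, hf, hb, hE⟩ := h
  have key : ∀ k ≤ n, MapsTo f (Γ.ball k) (Δ.ball k) ∧ SurjOn f (Γ.ball k) (Δ.ball k) := by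
    intro k
    induction k with
    | zero =>
      intro _
      refine ⟨fun x hx => ?_, fun y hy => ⟨Γ.base, rfl, ?_⟩⟩
      · rw [mem_singleton_iff.1 hx]; exact hb
      · rw [mem_singleton_iff.1 hy]; exact hb
    | succ k ih =>
      intro hk
      obtain ⟨ihm, ihs⟩ := ih (by omega)
      have hsub := Γ.ball_mono (show k ≤ n by omega)
      refine ⟨fun x hx => ?_, fun y hy => ?_⟩
      · have hxn := Γ.ball_mono hk hx
        rcases hx with hx | ⟨z, hz, s, hs⟩
        · exact Or.inl (ihm hx)
        · refine Or.inr ⟨f z, ihm hz, s, ?_⟩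
          rwa [← hE s z (hsub hz) x hxn, ← hE s x hxn z (hsub hz)]
      · obtain ⟨x, hx, rfl⟩ := hf.surjOn (Δ.ball_mono hk hy)
        rcases hy with hy | ⟨z, hz, s, hs⟩
        · obtain ⟨x', hx', h⟩ := ihs hy
          exact ⟨x', Or.inl hx', h⟩
        · obtain ⟨z', hz', rfl⟩ := ihs hz
          refine ⟨x, Or.inr ⟨z', hz', s, ?_⟩, rfl⟩
          rwa [hE s z' (hsub hz') x hx, hE s x hx z' (hsub hz')]
  exact ⟨f, ⟨(key m hmn).1, hf.injOn.mono (Γ.ball_mono hmn), (key m hmn).2⟩, hb,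
    fun s x hx y hy => hE s x (Γ.ball_mono hmn hx) y (Γ.ball_mono hmn hy)⟩

open Classical in
/-- The distance `2 ^ (-n)`, where `n` is the largest integer such that the balls of radius `n`
around the base vertices are isomorphic (`n = -1` if not even the balls of radius `0` are, and
`n = ∞` if all of them are). Since isomorphic balls of radius `n` contain isomorphic balls of all
smaller radii, this `n` is the predecessor of the smallest radius with non-isomorphic balls. -/
noncomputable def graphDist (Γ Δ : PGraph) : ℝ :=
  if h : ∃ n, ¬ BallIso n Γ Δ then 2 ^ (-((Nat.find h : ℤ) - 1)) else 0

theorem graphDist_le_iff (Γ Δ : PGraph) (n : ℕ) :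
    graphDist Γ Δ ≤ 2 ^ (-(n : ℤ)) ↔ BallIso n Γ Δ := by
  classical
  unfold graphDist
  split_ifs with h
  · rw [zpow_le_zpow_iff_right₀ (by norm_num : (1 : ℝ) < 2)]
    constructor
    · intro h'
      have : n < Nat.find h := by omega
      exact not_not.1 (Nat.find_min h this)
    · intro h'
      by_contra hlt
      exact Nat.find_spec h (h'.mono (by omega))
  · push Not at h
    exact iff_of_true (by positivity) (h n)

theorem graphDist_nonneg (Γ Δ : PGraph) : 0 ≤ graphDist Γ Δ := by
  unfold graphDist
  split_ifs <;> positivity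

theorem graphDist_self (Γ : PGraph) : graphDist Γ Γ = 0 := by
  unfold graphDist
  rw [dif_neg]
  push Not
  exact fun n => BallIso.refl n Γ

theorem graphDist_comm (Γ Δ : PGraph) : graphDist Γ Δ = graphDist Δ Γ := by
  have : ∀ n, BallIso n Γ Δ ↔ BallIso n Δ Γ := fun n => ⟨.symm, .symm⟩
  classical
  unfold graphDist
  split_ifs with h h' h'
  · rw [Nat.find_congr' (@fun n => not_congr (this n))]
  · exact absurd (h.imp fun n => (not_congr (this n)).1) h'
  · exact absurd (h'.imp fun n => (not_congr (this n)).2) h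
  · rfl

theorem graphDist_triangle (Γ Δ Θ : PGraph) :
    graphDist Γ Θ ≤ graphDist Γ Δ + graphDist Δ Θ := by
  classical
  by_cases h : ∃ n, ¬ BallIso n Γ Θ
  · have hor : ¬ BallIso (Nat.find h) Γ Δ ∨ ¬ BallIso (Nat.find h) Δ Θ := by
      by_contra hc
      push Not at hc
      exact Nat.find_spec h (hc.1.trans hc.2)
    have hle : ∀ Γ' Δ' : PGraph, ¬ BallIso (Nat.find h) Γ' Δ' →
        graphDist Γ Θ ≤ graphDist Γ' Δ' := by
      intro Γ' Δ' hn
      have h' : ∃ n, ¬ BallIso n Γ' Δ' := ⟨_, hn⟩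
      have hf : Nat.find h' ≤ Nat.find h := Nat.find_min' h' hn
      unfold graphDist
      rw [dif_pos h, dif_pos h', zpow_le_zpow_iff_right₀ (by norm_num : (1 : ℝ) < 2)]
      omega
    rcases hor with h1 | h1
    · linarith [hle _ _ h1, graphDist_nonneg Δ Θ]
    · linarith [hle _ _ h1, graphDist_nonneg Γ Δ]
  · have : graphDist Γ Θ = 0 := by
      unfold graphDist
      rw [dif_neg h]
    rw [this]
    exact add_nonneg (graphDist_nonneg _ _) (graphDist_nonneg _ _)

/-- The topology of pointed marked graphs. On isomorphism classes `graphDist` is a metric. -/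
noncomputable instance : PseudoMetricSpace PGraph where
  dist := graphDist
  dist_self := graphDist_self
  dist_comm := graphDist_comm
  dist_triangle := graphDist_triangle

end PGraph

/-! ### Schreier graphs of dyadic rationals -/

/-- The pointed Schreier graph `Γ_q` of the action of `F`, with generators `x₀, x₁`, on the orbit
of `q`: there is an edge labeled by `s` from `x` to `y` iff the generator `s` maps `x` to `y`. -/
def schreierGraph (q : DyadicPoint) : PGraph where
  V := MulAction.orbit thompsonF q.1
  E s x y := gen s • x = y
  base := ⟨q.1, MulAction.mem_orbit_self _⟩
  out_unique s x := ⟨gen s • x, rfl, fun _ h => h.symm⟩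
  in_unique s y := ⟨(gen s)⁻¹ • y, smul_inv_smul _ _, fun x h => by
    change gen s • x = y at h
    rw [← h, inv_smul_smul]⟩
  connected := by
    have key : ∀ g ∈ Subgroup.closure (Set.range gen), ∀ p : MulAction.orbit thompsonF q.1,
        Relation.EqvGen (fun x y : MulAction.orbit thompsonF q.1 => ∃ s, gen s • x = y)
          p (g • p) := by
      intro g hg
      induction hg using Subgroup.closure_induction with
      | mem x hx =>
        obtain ⟨s, rfl⟩ := hx
        exact fun p => .rel _ _ ⟨s, rfl⟩
      | one => intro p; rw [one_smul]; exact .refl _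
      | mul x y _ _ hx hy => intro p; rw [mul_smul]; exact .trans _ _ _ (hy p) (hx _)
      | inv x _ hx =>
        intro p
        have := hx (x⁻¹ • p)
        rw [smul_inv_smul] at this
        exact .symm _ _ this
    rintro ⟨v, f, rfl⟩
    obtain ⟨g, hg, h⟩ := q.exists_smul_eq (q.map f)
    have := key g hg ⟨q.1, MulAction.mem_orbit_self _⟩
    convert this using 1
    exact Subtype.ext h.symm

/-- The family of the pointed Schreier graphs of all dyadic rationals in `(0,1)`. -/
def dyadicFamily : Set PGraph := Set.range schreierGraph

/-! ### The limit graphs -/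

/-- The grey vertices of the graph with an infinite path going up from the grey vertex `s₀`,
through the grey vertices `s₁, s₂, …`:
* `below v` is reached from `s₀` by descending along the finite word `v`; `below []` is `s₀`;
* `above k` is `s_{k+1}`;
* `side k v` is reached by descending along the finite word `v` from the child of `s_{k+1}` that
  is not `s_k`.

Words of descending paths are written from bottom to top. The letter `0` is `false` and the letter
`1` is `true`. -/
inductive Grey : Type
  | below (v : List Bool)
  | above (k : ℕ)
  | side (k : ℕ) (v : List Bool)

/-- The grey vertex `s_k` of the infinite path. -/
def Grey.spine : ℕ → Grey
  | 0 => below []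
  | k + 1 => above k

/-- The left (`a = 0`) or right (`a = 1`) turn at the `k`-th level of the upward path is prescribed
by the `k`-th letter of `w`: `s_k` is the `w k`-child of `s_{k+1}`, and below all the other
children hang full binary trees. The child of a grey vertex with label `10u` given by the letter
`a` is the grey vertex with label `10au`. -/
def Grey.child (w : ℕ → Bool) (a : Bool) : Grey → Grey
  | below v => below (a :: v)
  | above k => if a = w k then spine k else side k []
  | side k v => side k (a :: v)

/-- Each grey vertex `g` with label `10u` lies on a line of vertices `(g, j)`, `j : ℤ`: for `j = 0`
this is the grey vertex `10u` itself, for `j ≥ 1` it is the black vertex with label `0^j 1u`, and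
for `j ≤ -1` it is the white vertex with label `1^(1-j) 0u`. This is the end of the edge labeled
by `s` that starts at a given vertex: `x₀` moves along the line; `x₁` fixes the black vertices,
leads from the grey vertex to its `0`-child, from the first white vertex to the `1`-child of the
grey vertex, and moves along the line at the other white vertices. -/
def limitStep (w : ℕ → Bool) : Fin 2 → Grey × ℤ → Grey × ℤ
  | 0, (g, j) => (g, j + 1)
  | 1, (g, j) =>
    if 1 ≤ j then (g, j)
    else if j = 0 then (g.child w false, 0)
    else if j = -1 then (g.child w true, 0)
    else (g, j + 1)

theorem Grey.child_ne (w : ℕ → Bool) (g h : Grey) : g.child w false ≠ h.child w true := by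
  rcases g with v | _ | k | ⟨k, v⟩ <;> rcases h with v' | _ | k' | ⟨k', v'⟩ <;>
    simp only [child, spine] <;> grind

theorem Grey.child_injective (w : ℕ → Bool) (a : Bool) :
    Function.Injective (Grey.child w a) := by
  intro g h
  rcases g with v | _ | k | ⟨k, v⟩ <;> rcases h with v' | _ | k' | ⟨k', v'⟩ <;>
    simp only [child, spine] <;> grind

theorem Grey.exists_child_eq (w : ℕ → Bool) (g : Grey) : ∃ a h, Grey.child w a h = g := by
  rcases g with (_ | ⟨a, v⟩) | k | ⟨k, (_ | ⟨a, v⟩)⟩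
  · exact ⟨w 0, above 0, by simp [child, spine]⟩
  · exact ⟨a, below v, rfl⟩
  · exact ⟨w (k + 1), above (k + 1), by simp [child, spine]⟩
  · exact ⟨!w k, above k, by simp [child]⟩
  · exact ⟨a, side k v, rfl⟩

theorem limitStep_injective (w : ℕ → Bool) (s : Fin 2) : Function.Injective (limitStep w s) := by
  rintro ⟨g, i⟩ ⟨h, j⟩ he
  have h1 := @Grey.child_injective w
  have h2 := Grey.child_ne w
  fin_cases s
  · simpa [limitStep] using he
  · simp only [limitStep] at he
    have h3 := @h1 false g h
    have h4 := @h1 true g h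
    have h5 := h2 g h
    have h6 := h2 h g
    split_ifs at he <;> simp only [Prod.mk.injEq] at he ⊢ <;> grind

theorem limitStep_surjective (w : ℕ → Bool) (s : Fin 2) :
    Function.Surjective (limitStep w s) := by
  rintro ⟨g, j⟩
  fin_cases s
  · exact ⟨(g, j - 1), by simp [limitStep]⟩
  · rcases lt_trichotomy j 0 with h | rfl | h
    · refine ⟨(g, j - 1), ?_⟩
      simp only [limitStep]
      rw [if_neg (by omega), if_neg (by omega), if_neg (by omega)]
      simp
    · obtain ⟨a, h, rfl⟩ := g.exists_child_eq w
      cases a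
      · exact ⟨(h, 0), by simp [limitStep]⟩
      · exact ⟨(h, -1), by simp [limitStep]⟩
    · exact ⟨(g, j), by simp only [limitStep]; rw [if_pos (by omega)]⟩

theorem limitGraph_connected (w : ℕ → Bool) (p v : Grey × ℤ) :
    Relation.EqvGen (fun x y => ∃ s, limitStep w s x = y) p v := by
  have line (g : Grey) (j : ℤ) :
      Relation.EqvGen (fun x y => ∃ s, limitStep w s x = y) (g, 0) (g, j) := by
    induction j using Int.induction_on with
    | zero => exact .refl _
    | succ i ih => exact ih.trans _ _ _ (.rel _ _ ⟨0, rfl⟩)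
    | pred i ih =>
      refine ih.trans _ _ _ (.symm _ _ (.rel _ _ ⟨0, ?_⟩))
      simp [limitStep]
  have child (a : Bool) (g : Grey) :
      Relation.EqvGen (fun x y => ∃ s, limitStep w s x = y) (g, 0) (g.child w a, 0) := by
    cases a
    · exact .rel _ _ ⟨1, by simp [limitStep]⟩
    · exact (line g (-1)).trans _ _ _ (.rel _ _ ⟨1, by simp [limitStep]⟩)
  have below (v : List Bool) : Relation.EqvGen (fun x y => ∃ s, limitStep w s x = y)
      (Grey.below [], 0) (Grey.below v, 0) := by
    induction v with
    | nil => exact .refl _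
    | cons a v ih => exact ih.trans _ _ _ (child a (.below v))
  have spine (k : ℕ) : Relation.EqvGen (fun x y => ∃ s, limitStep w s x = y)
      (Grey.below [], 0) (Grey.spine k, 0) := by
    induction k with
    | zero => exact .refl _
    | succ k ih =>
      refine ih.trans _ _ _ (.symm _ _ ?_)
      have := child (w k) (.above k)
      rwa [Grey.child, if_pos rfl] at this
  have side (k : ℕ) (v : List Bool) : Relation.EqvGen (fun x y => ∃ s, limitStep w s x = y)
      (Grey.below [], 0) (Grey.side k v, 0) := by
    induction v with
    | nil =>
      refine (spine (k + 1)).trans _ _ _ ?_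
      have := child (!w k) (.above k)
      rwa [Grey.child, if_neg (by simp)] at this
    | cons a v ih => exact ih.trans _ _ _ (child a (.side k v))
  have all (p : Grey × ℤ) : Relation.EqvGen (fun x y => ∃ s, limitStep w s x = y)
      (Grey.below [], 0) p := by
    obtain ⟨v | k | ⟨k, v⟩, j⟩ := p
    · exact (below v).trans _ _ _ (line _ _)
    · exact (spine (k + 1)).trans _ _ _ (line _ _)
    · exact (side k v).trans _ _ _ (line _ _)
  exact (Relation.EqvGen.symm _ _ (all p)).trans _ _ _ (all v)

/-- The graph with an infinite path going up from a grey vertex labeled by `10w`, which turns left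
or right at the `k`-th level if the `k`-th letter of `w` is `0` or `1`. The base vertex is the
vertex at position `j` of the line of that grey vertex. -/
def upwardGraph (w : ℕ → Bool) (j : ℤ) : PGraph where
  V := Grey × ℤ
  E s x y := limitStep w s x = y
  base := (Grey.spine 0, j)
  out_unique s x := ⟨limitStep w s x, rfl, fun _ h => h.symm⟩
  in_unique s y := Function.Bijective.existsUnique
    ⟨limitStep_injective w s, limitStep_surjective w s⟩ y
  connected := limitGraph_connected w _

/-- The two graphs that are quasi-isometric to a line: there is an edge labeled by `x₀` from each
integer `j` to `j + 1`; the edge labeled by `x₁` that starts at `j` is a loop in the first graph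
(`b = 0`) and goes to `j + 1` as well in the second one (`b = 1`). -/
def lineGraph (b : Bool) : PGraph where
  V := ℤ
  E s x y := y = if s = 1 ∧ b = false then x else x + 1
  base := 0
  out_unique _ _ := ⟨_, rfl, fun _ h => h⟩
  in_unique s y := by
    by_cases h : s = 1 ∧ b = false
    · exact ⟨y, by simp [h], fun x hx => by simpa [h] using hx.symm⟩
    · refine ⟨y - 1, by simp [h], fun x hx => ?_⟩
      simp only [h, if_false] at hx
      omega
  connected v := by
    induction v using Int.induction_on with
    | zero => exact .refl _
    | succ i ih => exact ih.trans _ _ _ (.rel _ _ ⟨0, by simp⟩)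
    | pred i ih => exact ih.trans _ _ _ (.symm _ _ (.rel _ _ ⟨0, by simp⟩))

/-- The infinite word `a^n b w`, where `b` is the letter different from `a`. -/
def blockWord (a : Bool) (n : ℕ) (w : ℕ → Bool) : ℕ → Bool := fun i =>
  if i < n then a else if i = n then !a else w (i - n - 1)

open Classical in
/-- The limit graph `Γ̃_ξ` whose base vertex has the label `ξ`. If `ξ = 1^n 0 w` with `n ≥ 1`, the
base vertex is the grey vertex `10w` or a white vertex of its line; if `ξ = 0^n 1 w` with `n ≥ 1`,
it is a black vertex of the line of the grey vertex `10w`; if `ξ` is constant, the graph is a line.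
Here `n` is the number of letters in the first block of `ξ`. -/
noncomputable def limitGraph (ξ : ℕ → Bool) : PGraph :=
  if h : ∃ n, ξ n ≠ ξ 0 then
    upwardGraph (fun i => ξ (Nat.find h + 1 + i))
      (if ξ 0 = true then 1 - (Nat.find h : ℤ) else (Nat.find h : ℤ))
  else lineGraph (ξ 0)

/-- The two cases of the definition of `limitGraph` for non-constant labels. -/
theorem limitGraph_blockWord (a : Bool) (n : ℕ) (hn : 1 ≤ n) (w : ℕ → Bool) :
    limitGraph (blockWord a n w) = upwardGraph w (if a = true then 1 - (n : ℤ) else n) := by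
  classical
  have h0 : blockWord a n w 0 = a := if_pos (by omega)
  have hne : ∃ m, blockWord a n w m ≠ blockWord a n w 0 := ⟨n, by rw [h0]; simp [blockWord]⟩
  have hfind : Nat.find hne = n := by
    rw [Nat.find_eq_iff]
    refine ⟨by rw [h0]; simp [blockWord], fun m hm => ?_⟩
    rw [h0]
    simp [blockWord, hm]
  unfold limitGraph
  rw [dif_pos hne, hfind, h0]
  congr 1
  funext i
  simp only [blockWord]
  rw [if_neg (by omega), if_neg (by omega)]
  congr 1
  omega

theorem limitGraph_const (a : Bool) : limitGraph (fun _ => a) = lineGraph a := by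
  simp [limitGraph]

end ThompsonSchreier

/-!
A marked graph is a transitive action of the free group `𝔽` on `x₀`, `x₁` with a base point, so up
to isomorphism it is the subgroup of `𝔽` formed by the labels of the loops at the base point, and
graphs converge if and only if these subgroups converge pointwise. For the Schreier graph of a
dyadic rational `q`, the subgroup is the stabilizer of the binary expansion of `q`, where `𝔽` acts
on infinite binary words by the replacement of prefixes.

Near a word `ξ`, such a replacement either fixes every word or fixes no word other than `ξ`. Hence
the stabilizers of words that tend to `ξ`, and differ from `ξ`, converge to the subgroup of the
elements that act trivially near `ξ`. Since the space of words is compact and the expansions of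
dyadic rationals are dense in it, the closure consists of the graphs of the dyadic rationals and
of the limits obtained in this way. The limit at `ξ` is `Γ̃_ξ`, realized by the germs at `ξ` of the
maps `z ↦ g • z`: the germs whose values start with `10` are the grey vertices, and `x₀` moves along
their lines.

The limits are distinct: `x₁` acts trivially near `ξ` if and only if `ξ` starts with `0`, and any
letter of `ξ` can be moved to the first place by the action.
-/

namespace ThompsonSchreier

open Set Filter Topology
open scoped unitInterval
open MulAction (stabilizer mem_stabilizer_iff)

local notation "𝔽" => FreeGroup (Fin 2)

/-! ### Free groups -/

section FreeGroup

variable {α : Type*}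

theorem freeGroup_map_smul {X Y : Type*} [MulAction (FreeGroup α) X] [MulAction (FreeGroup α) Y]
    {f : X → Y} (hf : ∀ (a : α) (x : X), f (FreeGroup.of a • x) = FreeGroup.of a • f x)
    (g : FreeGroup α) (x : X) : f (g • x) = g • f x := by
  induction g using FreeGroup.induction_on generalizing x with
  | C1 => rw [one_smul, one_smul]
  | of a => exact hf a x
  | inv_of a _ => rw [eq_inv_smul_iff, ← hf, smul_inv_smul]
  | mul g h ihg ihh => rw [mul_smul, mul_smul, ihg, ihh]

variable [DecidableEq α]

theorem finite_setOf_norm_le [Finite α] (n : ℕ) : {g : FreeGroup α | g.norm ≤ n}.Finite :=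
  (List.finite_length_le (α × Bool) n).preimage FreeGroup.toWord_injective.injOn

theorem exists_norm_le_of_norm_le_succ {n : ℕ} {g : FreeGroup α} (hg : g.norm ≤ n + 1) :
    ∃ h : FreeGroup α, h.norm ≤ n ∧
      (g = h ∨ ∃ a, g = FreeGroup.of a * h ∨ h = FreeGroup.of a * g) := by
  rcases hword : g.toWord with _ | ⟨⟨a, b⟩, l⟩
  · exact ⟨1, by simp, .inl (FreeGroup.toWord_eq_nil_iff.1 hword)⟩
  · have hgl : g = FreeGroup.mk [(a, b)] * FreeGroup.mk l := by
      rw [FreeGroup.mul_mk, List.singleton_append, ← hword, FreeGroup.mk_toWord]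
    have hl : l.length ≤ n := by simpa [FreeGroup.norm, hword] using hg
    refine ⟨FreeGroup.mk l, FreeGroup.norm_mk_le.trans hl, .inr ⟨a, ?_⟩⟩
    cases b
    · exact .inr (by rw [hgl, show FreeGroup.mk [(a, false)] = (FreeGroup.of a)⁻¹ from rfl,
        mul_inv_cancel_left])
    · exact .inl hgl

theorem norm_inv_mul_le (g h : FreeGroup α) : (g⁻¹ * h).norm ≤ g.norm + h.norm :=
  (FreeGroup.norm_mul_le _ _).trans_eq (by rw [FreeGroup.norm_inv_eq])

theorem norm_of_mul_le (a : α) (g : FreeGroup α) : (FreeGroup.of a * g).norm ≤ g.norm + 1 :=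
  (FreeGroup.norm_mul_le _ _).trans_eq (by rw [FreeGroup.norm_of, add_comm])

end FreeGroup

/-! ### Marked graphs as pointed actions of the free group -/

namespace PGraph

variable {Γ Δ : PGraph}

variable (Γ) in
/-- The permutation of the vertices along the edges labeled by `s`. -/
noncomputable def step (s : Fin 2) : Equiv.Perm Γ.V where
  toFun x := (Γ.out_unique s x).choose
  invFun y := (Γ.in_unique s y).choose
  left_inv x := ((Γ.in_unique s _).choose_spec.2 x (Γ.out_unique s x).choose_spec.1).symm
  right_inv y := ((Γ.out_unique s _).choose_spec.2 y (Γ.in_unique s y).choose_spec.1).symm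

/-- The free group on the labels acts on the vertices: its generators move along the edges. -/
noncomputable instance mulAction : MulAction 𝔽 Γ.V := MulAction.compHom Γ.V (FreeGroup.lift Γ.step)

theorem of_smul_eq_iff {s : Fin 2} {x y : Γ.V} : FreeGroup.of s • x = y ↔ Γ.E s x y := by
  have hstep : FreeGroup.of s • x = Γ.step s x :=
    congrArg (· x) (FreeGroup.lift_apply_of (f := Γ.step))
  rw [hstep]
  exact ⟨fun h => h ▸ (Γ.out_unique s x).choose_spec.1,
    fun h => ((Γ.out_unique s x).choose_spec.2 y h).symm⟩

theorem exists_smul_base_eq (v : Γ.V) : ∃ g : 𝔽, g • Γ.base = v := by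
  suffices key : ∀ x y, Relation.EqvGen (fun x y => ∃ s, Γ.E s x y) x y → ∃ g : 𝔽, g • x = y from
    key _ _ (Γ.connected v)
  intro x y h
  induction h with
  | rel x y h =>
    obtain ⟨s, h⟩ := h
    exact ⟨FreeGroup.of s, of_smul_eq_iff.2 h⟩
  | refl x => exact ⟨1, one_smul _ x⟩
  | symm x y _ ih =>
    obtain ⟨g, rfl⟩ := ih
    exact ⟨g⁻¹, inv_smul_smul g x⟩
  | trans x y z _ _ ihxy ihyz =>
    obtain ⟨g, rfl⟩ := ihxy
    obtain ⟨h, rfl⟩ := ihyz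
    exact ⟨h * g, mul_smul h g x⟩

theorem mem_ball_iff {n : ℕ} {v : Γ.V} : v ∈ Γ.ball n ↔ ∃ g : 𝔽, g.norm ≤ n ∧ g • Γ.base = v := by
  induction n generalizing v with
  | zero => simp [ball, FreeGroup.norm_eq_zero, eq_comm (a := v)]
  | succ n ih =>
    constructor
    · rintro (hv | ⟨x, hx, s, hE⟩)
      · obtain ⟨g, hg, rfl⟩ := ih.1 hv
        exact ⟨g, hg.trans n.le_succ, rfl⟩
      obtain ⟨g, hg, rfl⟩ := ih.1 hx
      rcases hE with hE | hE
      · exact ⟨FreeGroup.of s * g, (norm_of_mul_le s g).trans (by omega),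
          (mul_smul _ _ _).trans (of_smul_eq_iff.2 hE)⟩
      · refine ⟨(FreeGroup.of s)⁻¹ * g, (norm_inv_mul_le _ g).trans ?_, ?_⟩
        · rw [FreeGroup.norm_of]
          omega
        · rw [mul_smul, inv_smul_eq_iff, of_smul_eq_iff.2 hE]
    · rintro ⟨g, hg, rfl⟩
      obtain ⟨h, hh, rfl | ⟨s, rfl | rfl⟩⟩ := exists_norm_le_of_norm_le_succ hg
      · exact .inl (ih.2 ⟨g, hh, rfl⟩)
      · exact .inr ⟨_, ih.2 ⟨h, hh, rfl⟩, s, .inl (of_smul_eq_iff.1 (mul_smul _ _ _).symm)⟩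
      · exact .inr ⟨_, ih.2 ⟨_, hh, rfl⟩, s, .inr (of_smul_eq_iff.1 (mul_smul _ _ _).symm)⟩

theorem map_smul_of_E {Y : Type*} [MulAction 𝔽 Y] {f : Γ.V → Y}
    (hf : ∀ s x y, Γ.E s x y → FreeGroup.of s • f x = f y) (g : 𝔽) (x : Γ.V) :
    f (g • x) = g • f x :=
  freeGroup_map_smul (fun s x => (hf s x _ (of_smul_eq_iff.1 rfl)).symm) g x

variable (Γ) in
/-- The labels of the closed paths at the base vertex, as a subgroup of the free group. It
determines the pointed graph up to isomorphism. -/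
noncomputable def loops : Subgroup 𝔽 := stabilizer 𝔽 Γ.base

theorem inv_mul_mem_loops_iff {g h : 𝔽} : g⁻¹ * h ∈ Γ.loops ↔ h • Γ.base = g • Γ.base := by
  rw [loops, mem_stabilizer_iff, mul_smul, inv_smul_eq_iff]

theorem loops_eq_stabilizer {Y : Type*} [MulAction 𝔽 Y] {f : Γ.V → Y}
    (hf : ∀ s x y, Γ.E s x y → FreeGroup.of s • f x = f y)
    (hbase : ∀ x, f x = f Γ.base → x = Γ.base) : Γ.loops = stabilizer 𝔽 (f Γ.base) := by
  ext g
  rw [loops, mem_stabilizer_iff, mem_stabilizer_iff, ← map_smul_of_E hf]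
  exact ⟨congrArg f, hbase _⟩

theorem exists_bijOn_image_smul_base {T : Set 𝔽} (h_one : 1 ∈ T)
    (hT : ∀ g ∈ T, ∀ h ∈ T, g⁻¹ * h ∈ Γ.loops ↔ g⁻¹ * h ∈ Δ.loops)
    (hE : ∀ s, ∀ g ∈ T, ∀ h ∈ T,
      g⁻¹ * (FreeGroup.of s * h) ∈ Γ.loops ↔ g⁻¹ * (FreeGroup.of s * h) ∈ Δ.loops) :
    ∃ f : Γ.V → Δ.V, BijOn f ((· • Γ.base) '' T) ((· • Δ.base) '' T) ∧ f Γ.base = Δ.base ∧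
      ∀ s, ∀ x ∈ (· • Γ.base) '' T, ∀ y ∈ (· • Γ.base) '' T, Γ.E s x y ↔ Δ.E s (f x) (f y) := by
  simp only [inv_mul_mem_loops_iff] at hT hE
  obtain ⟨f, hf⟩ : ∃ f : Γ.V → Δ.V, ∀ g ∈ T, f (g • Γ.base) = g • Δ.base := by
    refine ⟨fun x => Function.invFunOn (· • Γ.base) T x • Δ.base, fun g hg => ?_⟩
    have hg' := mem_image_of_mem (· • Γ.base) hg
    exact (hT g hg _ (Function.invFunOn_mem hg')).1 (Function.invFunOn_eq hg')
  refine ⟨f, ⟨?_, ?_, ?_⟩, ?_, ?_⟩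
  · rintro _ ⟨g, hg, rfl⟩
    exact ⟨g, hg, (hf g hg).symm⟩
  · rintro _ ⟨g, hg, rfl⟩ _ ⟨h, hh, rfl⟩ hgh
    simp only [hf g hg, hf h hh] at hgh
    exact (hT h hh g hg).2 hgh
  · rintro _ ⟨g, hg, rfl⟩
    exact ⟨_, ⟨g, hg, rfl⟩, hf g hg⟩
  · simpa using hf 1 h_one
  · rintro s _ ⟨g, hg, rfl⟩ _ ⟨h, hh, rfl⟩
    simp only [hf g hg, hf h hh, ← of_smul_eq_iff, ← mul_smul]
    exact hE s h hh g hg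

theorem Iso.loops_eq (h : Γ.Iso Δ) : Γ.loops = Δ.loops := by
  obtain ⟨e, hbase, hE⟩ := h
  rw [loops_eq_stabilizer (f := e) (fun s x y h => of_smul_eq_iff.2 ((hE s x y).1 h))
    (fun x h => e.injective h), hbase, loops]

theorem iso_iff_loops_eq : Γ.Iso Δ ↔ Γ.loops = Δ.loops := by
  refine ⟨Iso.loops_eq, fun h => ?_⟩
  have hrange (Θ : PGraph) : range (fun g : 𝔽 => g • Θ.base) = univ :=
    range_eq_univ.2 exists_smul_base_eq
  obtain ⟨f, hf, hbase, hE⟩ := exists_bijOn_image_smul_base (Γ := Γ) (Δ := Δ) (mem_univ 1)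
    (by simp [h]) (by simp [h])
  simp only [image_univ, hrange] at hf hE
  exact ⟨Equiv.ofBijective f (bijOn_univ.1 hf), hbase, fun s x y => hE s x trivial y trivial⟩

theorem ballIso_of_loops {n : ℕ}
    (h : ∀ g : 𝔽, g.norm ≤ 2 * n + 1 → (g ∈ Γ.loops ↔ g ∈ Δ.loops)) : BallIso n Γ Δ := by
  have hball (Θ : PGraph) : (· • Θ.base) '' {g : 𝔽 | g.norm ≤ n} = Θ.ball n :=
    ext fun _ => mem_ball_iff.symm
  rw [BallIso, ← hball, ← hball]
  refine exists_bijOn_image_smul_base (by simp) (fun g hg k hk => h _ ?_)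
    (fun s g hg k hk => h _ ?_) <;> rw [mem_ofPred_eq] at hg hk
  · have := norm_inv_mul_le g k
    omega
  · have := norm_inv_mul_le g (FreeGroup.of s * k)
    have := norm_of_mul_le s k
    omega

theorem BallIso.mem_loops_iff {n : ℕ} (h : BallIso n Γ Δ) {g : 𝔽} (hg : g.norm ≤ n) :
    g ∈ Γ.loops ↔ g ∈ Δ.loops := by
  obtain ⟨f, hf, hbase, hE⟩ := h
  have hsmul (m : ℕ) (hm : m ≤ n) :
      ∀ g : 𝔽, g.norm ≤ m → g • Γ.base ∈ Γ.ball n ∧ f (g • Γ.base) = g • Δ.base := by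
    induction m with
    | zero => simp [FreeGroup.norm_eq_zero, hbase, Γ.base_mem_ball]
    | succ m ih =>
      intro g hg
      have hgn : g • Γ.base ∈ Γ.ball n := mem_ball_iff.2 ⟨g, hg.trans hm, rfl⟩
      refine ⟨hgn, ?_⟩
      obtain ⟨h, hh, rfl | ⟨s, rfl | rfl⟩⟩ := exists_norm_le_of_norm_le_succ hg
      · exact (ih (by omega) g hh).2
      · obtain ⟨hhn, hfh⟩ := ih (by omega) h hh
        rw [mul_smul (FreeGroup.of s) h Δ.base, ← hfh, eq_comm, of_smul_eq_iff,
          ← hE s _ hhn _ hgn, ← of_smul_eq_iff, mul_smul]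
      · obtain ⟨hhn, hfh⟩ := ih (by omega) _ hh
        rw [← smul_left_cancel_iff (FreeGroup.of s), ← mul_smul, ← hfh, of_smul_eq_iff,
          ← hE s _ hgn _ hhn, ← of_smul_eq_iff, mul_smul]
  obtain ⟨hgn, hfg⟩ := hsmul n le_rfl g hg
  rw [loops, loops, mem_stabilizer_iff, mem_stabilizer_iff, ← hf.injOn.eq_iff hgn
    (Γ.base_mem_ball n), hfg, hbase]

theorem tendsto_nhds_iff {ι : Type*} {l : Filter ι} {f : ι → PGraph} :
    Tendsto f l (𝓝 Γ) ↔ ∀ g : 𝔽, ∀ᶠ i in l, (g ∈ (f i).loops ↔ g ∈ Γ.loops) := by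
  have hbasis : Tendsto f l (𝓝 Γ) ↔ ∀ n, ∀ᶠ i in l, BallIso n (f i) Γ := by
    simp only [(Metric.nhds_basis_closedBall_pow (r := 1 / 2) (by norm_num)
      (by norm_num)).tendsto_right_iff, Metric.mem_closedBall, true_imp_iff, ← graphDist_le_iff,
      one_div, inv_pow, zpow_neg, zpow_natCast]
    rfl
  rw [hbasis]
  refine ⟨fun h g => (h g.norm).mono fun i hi => hi.mem_loops_iff le_rfl, fun h n => ?_⟩
  filter_upwards [(eventually_all_finite (finite_setOf_norm_le (2 * n + 1))).2 fun g _ => h g]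
    with i hi using ballIso_of_loops hi

end PGraph

/-! ### Stabilizers of germs -/

section EventualStabilizer

variable (G : Type*) {X Y : Type*} [Group G] [MulAction G X]

/-- The elements of `G` that fix the points of `X` eventually along the filter `l`. For a
neighbourhood filter, this is the subgroup of the elements that act trivially near a point. -/
def eventualStabilizer (l : Filter X) : Subgroup G := stabilizer G ((id : X → X) : Germ l X)

variable {G}

theorem mem_eventualStabilizer_iff {l : Filter X} {g : G} :
    g ∈ eventualStabilizer G l ↔ ∀ᶠ x in l, g • x = x :=
  Germ.coe_eq

theorem stabilizer_coe_germ (l : Filter Y) (f : Y → X) :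
    stabilizer G (f : Germ l X) = eventualStabilizer G (map f l) := by
  ext g
  rw [mem_eventualStabilizer_iff, eventually_map, mem_stabilizer_iff, ← Germ.coe_smul]
  exact Germ.coe_eq

theorem eventualStabilizer_pure (x : X) : eventualStabilizer G (pure x) = stabilizer G x := by
  ext g
  rw [mem_eventualStabilizer_iff, eventually_pure, mem_stabilizer_iff]

theorem conj_mem_eventualStabilizer_iff {l : Filter X}
    {g h : G} :
    g⁻¹ * h * g ∈ eventualStabilizer G l ↔ h ∈ eventualStabilizer G (map (g • ·) l) := by
  simp only [mem_eventualStabilizer_iff, eventually_map, mul_smul, inv_smul_eq_iff]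

end EventualStabilizer

/-! ### The action on binary words -/

/-- Infinite binary words, with the product topology; `false` is the letter `0` and `true` is the
letter `1`. -/
abbrev BinaryWord : Type := ℕ → Bool

namespace BinaryWord

/-- The word `u` with a new first letter `a`. -/
def cons (a : Bool) (u : BinaryWord) : BinaryWord
  | 0 => a
  | i + 1 => u i

/-- The word `u` without its first `n` letters. -/
def drop (n : ℕ) (u : BinaryWord) : BinaryWord := fun i => u (n + i)

end BinaryWord

local infixr:67 " ∷ " => BinaryWord.cons

namespace BinaryWord

@[simp] theorem cons_zero (a : Bool) (u : BinaryWord) : (a ∷ u) 0 = a := rfl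

@[simp] theorem cons_succ (a : Bool) (u : BinaryWord) (i : ℕ) : (a ∷ u) (i + 1) = u i := rfl

@[simp] theorem drop_zero (u : BinaryWord) : drop 0 u = u := funext fun i => congrArg u (zero_add i)

@[simp] theorem drop_succ_cons (n : ℕ) (a : Bool) (u : BinaryWord) :
    drop (n + 1) (a ∷ u) = drop n u := by
  funext i
  exact congrArg (a ∷ u) (Nat.add_right_comm n 1 i)

theorem cons_drop_succ (n : ℕ) (u : BinaryWord) : u n ∷ drop (n + 1) u = drop n u := by
  funext i
  cases i
  · rfl
  · exact congrArg u (by omega)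

theorem drop_drop (m n : ℕ) (u : BinaryWord) : drop m (drop n u) = drop (n + m) u :=
  funext fun i => congrArg u (add_assoc n m i).symm

theorem exists_eq_cons (u : BinaryWord) : ∃ a v, u = a ∷ v :=
  ⟨u 0, drop 1 u, by rw [cons_drop_succ, drop_zero]⟩

theorem cons_injective2 : Function.Injective2 cons := fun _ _ _ _ h =>
  ⟨congrFun h 0, funext fun i => congrFun h (i + 1)⟩

theorem continuous_cons (a : Bool) : Continuous (cons a) :=
  continuous_pi fun
    | 0 => continuous_const
    | i + 1 => continuous_apply i

theorem continuous_drop (n : ℕ) : Continuous (drop n) :=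
  continuous_pi fun i => continuous_apply (n + i)

theorem eventually_apply_eq (ξ : BinaryWord) (i : ℕ) : ∀ᶠ z in 𝓝 ξ, z i = ξ i := by
  have h : Tendsto (fun z : BinaryWord => z i) (𝓝 ξ) (𝓝 (ξ i)) := (continuous_apply i).tendsto ξ
  rwa [nhds_discrete Bool, tendsto_pure] at h

theorem eventually_forall_lt_apply_eq (ξ : BinaryWord) (n : ℕ) :
    ∀ᶠ z in 𝓝 ξ, ∀ i < n, z i = ξ i :=
  (eventually_all_finite (finite_lt_nat n)).2 fun i _ => eventually_apply_eq ξ i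

theorem continuous_ite_apply_eq {f g : BinaryWord → BinaryWord} (hf : Continuous f)
    (hg : Continuous g) (i : ℕ) (a : Bool) :
    Continuous fun u => if u i = a then f u else g u := by
  have hclopen : IsClopen {u : BinaryWord | u i = a} :=
    (isClopen_discrete {a}).preimage (continuous_apply i)
  exact hf.if (by simp [hclopen.frontier_eq]) hg

/-- The generator `x₀` on binary expansions: it replaces the prefix `0` by `00`, the prefix `10` by
`01`, and the prefix `11` by `1`. -/
def permX0 : Equiv.Perm BinaryWord where
  toFun u := if u 0 = false then false ∷ u else
    if u 1 = false then false ∷ true ∷ drop 2 u else drop 1 u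
  invFun u := if u 0 = true then true ∷ u else
    if u 1 = true then true ∷ false ∷ drop 2 u else drop 1 u
  left_inv u := by
    obtain ⟨a, u, rfl⟩ := exists_eq_cons u
    obtain ⟨b, u, rfl⟩ := exists_eq_cons u
    cases a <;> cases b <;> simp
  right_inv u := by
    obtain ⟨a, u, rfl⟩ := exists_eq_cons u
    obtain ⟨b, u, rfl⟩ := exists_eq_cons u
    cases a <;> cases b <;> simp

/-- The generator `x₁` on binary expansions: it acts as `x₀` behind the first letter of the words
that start with `1`, and fixes the others. -/
def permX1 : Equiv.Perm BinaryWord where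
  toFun u := if u 0 = true then true ∷ permX0 (drop 1 u) else u
  invFun u := if u 0 = true then true ∷ permX0.symm (drop 1 u) else u
  left_inv u := by
    obtain ⟨a, u, rfl⟩ := exists_eq_cons u
    cases a <;> simp
  right_inv u := by
    obtain ⟨a, u, rfl⟩ := exists_eq_cons u
    cases a <;> simp

/-- Thompson's group acts on infinite binary words through binary expansions; this is the action of
the free group on the symbols of its two generators. -/
instance : MulAction 𝔽 BinaryWord :=
  MulAction.compHom BinaryWord (FreeGroup.lift ![permX0, permX1])

theorem of_zero_smul (u : BinaryWord) : FreeGroup.of (0 : Fin 2) • u = permX0 u :=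
  congrArg (· u) (FreeGroup.lift_apply_of (f := ![permX0, permX1]))

theorem of_one_smul (u : BinaryWord) : FreeGroup.of (1 : Fin 2) • u = permX1 u :=
  congrArg (· u) (FreeGroup.lift_apply_of (f := ![permX0, permX1]))

@[simp] theorem of_zero_smul_false (u : BinaryWord) :
    FreeGroup.of (0 : Fin 2) • (false ∷ u) = false ∷ false ∷ u := by
  simp [of_zero_smul, permX0]

@[simp] theorem of_zero_smul_true_false (u : BinaryWord) :
    FreeGroup.of (0 : Fin 2) • (true ∷ false ∷ u) = false ∷ true ∷ u := by
  simp [of_zero_smul, permX0]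

@[simp] theorem of_zero_smul_true_true (u : BinaryWord) :
    FreeGroup.of (0 : Fin 2) • (true ∷ true ∷ u) = true ∷ u := by
  simp [of_zero_smul, permX0]

@[simp] theorem of_one_smul_false (u : BinaryWord) :
    FreeGroup.of (1 : Fin 2) • (false ∷ u) = false ∷ u := by
  simp [of_one_smul, permX1]

@[simp] theorem of_one_smul_true (u : BinaryWord) :
    FreeGroup.of (1 : Fin 2) • (true ∷ u) = true ∷ FreeGroup.of (0 : Fin 2) • u := by
  simp [of_one_smul, of_zero_smul, permX1]

theorem of_zero_inv_smul_false_false (u : BinaryWord) :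
    (FreeGroup.of (0 : Fin 2))⁻¹ • (false ∷ false ∷ u) = false ∷ u := by
  rw [inv_smul_eq_iff, of_zero_smul_false]

theorem of_zero_inv_smul_false_true (u : BinaryWord) :
    (FreeGroup.of (0 : Fin 2))⁻¹ • (false ∷ true ∷ u) = true ∷ false ∷ u := by
  rw [inv_smul_eq_iff, of_zero_smul_true_false]

theorem of_one_inv_smul_true (u : BinaryWord) :
    (FreeGroup.of (1 : Fin 2))⁻¹ • (true ∷ u) = true ∷ (FreeGroup.of (0 : Fin 2))⁻¹ • u := by
  rw [inv_smul_eq_iff, of_one_smul_true, smul_inv_smul]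

theorem continuous_permX0 : Continuous permX0 :=
  continuous_ite_apply_eq (continuous_cons _) (continuous_ite_apply_eq
    ((continuous_cons _).comp ((continuous_cons _).comp (continuous_drop 2))) (continuous_drop 1)
    1 false) 0 false

theorem continuous_permX1 : Continuous permX1 :=
  continuous_ite_apply_eq ((continuous_cons _).comp (continuous_permX0.comp (continuous_drop 1)))
    continuous_id 0 true

instance : ContinuousConstSMul 𝔽 BinaryWord where
  continuous_const_smul g := by
    induction g using FreeGroup.induction_on with
    | C1 => exact continuous_id.congr fun u => (one_smul 𝔽 u).symm
    | of s =>
      fin_cases s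
      · exact continuous_permX0.congr fun u => (of_zero_smul u).symm
      · exact continuous_permX1.congr fun u => (of_one_smul u).symm
    | inv_of s hs =>
      exact Continuous.continuous_symm_of_equiv_compact_to_t2
        (f := MulAction.toPerm (FreeGroup.of s)) hs
    | mul g h hg hh => exact (hg.comp hh).congr fun u => (mul_smul g h u).symm

/-! ### Germs of the action -/

theorem exists_tail_of_zero_smul (ξ : BinaryWord) :
    ∃ m n, ∀ᶠ z in 𝓝 ξ, drop n (FreeGroup.of (0 : Fin 2) • z) = drop m z := by
  obtain ⟨a, ξ, rfl⟩ := exists_eq_cons ξ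
  obtain ⟨b, ξ, rfl⟩ := exists_eq_cons ξ
  have hprefix := (eventually_apply_eq (a ∷ b ∷ ξ) 0).and (eventually_apply_eq (a ∷ b ∷ ξ) 1)
  refine ⟨2, bif a then bif b then 1 else 2 else 3, hprefix.mono fun z hz => ?_⟩
  obtain ⟨c, z, rfl⟩ := exists_eq_cons z
  obtain ⟨d, z, rfl⟩ := exists_eq_cons z
  obtain ⟨rfl, rfl⟩ : c = a ∧ d = b := hz
  cases c <;> cases d <;> simp

theorem exists_tail_of_one_smul (ξ : BinaryWord) :
    ∃ m n, ∀ᶠ z in 𝓝 ξ, drop n (FreeGroup.of (1 : Fin 2) • z) = drop m z := by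
  obtain ⟨a, ξ, rfl⟩ := exists_eq_cons ξ
  obtain ⟨m, n, h⟩ := exists_tail_of_zero_smul ξ
  have hdrop := (continuous_drop 1).tendsto (a ∷ ξ)
  rw [drop_succ_cons, drop_zero] at hdrop
  cases a
  · refine ⟨0, 0, (eventually_apply_eq _ 0).mono fun z hz => ?_⟩
    obtain ⟨c, z, rfl⟩ := exists_eq_cons z
    obtain rfl : c = false := hz
    simp
  · refine ⟨m + 1, n + 1, ((eventually_apply_eq _ 0).and (hdrop.eventually h)).mono ?_⟩
    rintro z ⟨hz, hzmn⟩
    obtain ⟨c, z, rfl⟩ := exists_eq_cons z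
    obtain rfl : c = true := hz
    simpa using hzmn

theorem exists_tail_smul (g : 𝔽) (ξ : BinaryWord) :
    ∃ m n, ∀ᶠ z in 𝓝 ξ, drop n (g • z) = drop m z := by
  induction g using FreeGroup.induction_on generalizing ξ with
  | C1 => exact ⟨0, 0, by simp⟩
  | of s =>
    fin_cases s
    · exact exists_tail_of_zero_smul ξ
    · exact exists_tail_of_one_smul ξ
  | inv_of s ih =>
    obtain ⟨m, n, h⟩ := ih ((FreeGroup.of s)⁻¹ • ξ)
    refine ⟨n, m, ((continuous_const_smul (FreeGroup.of s)⁻¹).tendsto ξ).eventually h |>.mono ?_⟩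
    intro z hz
    rw [← hz, smul_inv_smul]
  | mul g h ihg ihh =>
    obtain ⟨m, n, hg⟩ := ihg (h • ξ)
    obtain ⟨m', n', hh⟩ := ihh ξ
    refine ⟨m' + m, n + n', ?_⟩
    filter_upwards [((continuous_const_smul h).tendsto ξ).eventually hg, hh] with z hgz hhz
    rw [mul_smul, ← drop_drop, hgz, drop_drop, add_comm, ← drop_drop, hhz, drop_drop]

theorem eventually_drop_ne_drop (ξ : BinaryWord) {m n : ℕ} (hmn : m ≠ n) :
    ∀ᶠ z in 𝓝[≠] ξ, drop m z ≠ drop n z := by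
  wlog hlt : m < n generalizing m n
  · exact (this hmn.symm (by omega)).mono fun z hz => hz.symm
  by_cases hξ : drop m ξ = drop n ξ
  · filter_upwards [(eventually_forall_lt_apply_eq ξ n).filter_mono nhdsWithin_le_nhds,
      self_mem_nhdsWithin] with z hz hne h
    refine hne (funext fun i => ?_)
    induction i using Nat.strong_induction_on with
    | _ i ih =>
      rcases lt_or_ge i n with hi | hi
      · exact hz i hi
      · obtain ⟨i, rfl⟩ := Nat.exists_eq_add_of_le hi
        exact (congrFun h i).symm.trans ((ih (m + i) (by omega)).trans (congrFun hξ i))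
  · exact mem_nhdsWithin_of_mem_nhds
      ((isOpen_ne_fun (continuous_drop m) (continuous_drop n)).mem_nhds hξ)

theorem eventually_smul_eq_or_ne (g : 𝔽) (ξ : BinaryWord) :
    (∀ᶠ z in 𝓝 ξ, g • z = z) ∨ ∀ᶠ z in 𝓝[≠] ξ, g • z ≠ z := by
  by_cases hξ : g • ξ = ξ
  swap
  · exact .inr (mem_nhdsWithin_of_mem_nhds
      ((isOpen_ne_fun (continuous_const_smul g) continuous_id).mem_nhds hξ))
  obtain ⟨m, n, hg⟩ := exists_tail_smul g ξ
  obtain rfl | hmn := eq_or_ne m n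
  · refine .inl ?_
    have hgξ := (continuous_const_smul g).tendsto ξ
    rw [hξ] at hgξ
    filter_upwards [hg, eventually_forall_lt_apply_eq ξ m,
      hgξ.eventually (eventually_forall_lt_apply_eq ξ m)] with z hgz hz hgz'
    refine funext fun i => ?_
    rcases lt_or_ge i m with hi | hi
    · rw [hgz' i hi, hz i hi]
    · obtain ⟨i, rfl⟩ := Nat.exists_eq_add_of_le hi
      exact congrFun hgz i
  · refine .inr ?_
    filter_upwards [hg.filter_mono nhdsWithin_le_nhds, eventually_drop_ne_drop ξ hmn]
      with z hgz hz h
    exact hz (by rw [← hgz, h])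

theorem tendsto_update_nhds (ξ : BinaryWord) (f : ℕ → Bool) :
    Tendsto (fun n => Function.update ξ n (f n)) atTop (𝓝 ξ) := by
  refine tendsto_pi_nhds.2 fun i => tendsto_nhds_of_eventually_eq ?_
  filter_upwards [eventually_gt_atTop i] with n hn
  exact Function.update_of_ne hn.ne _ _

instance (ξ : BinaryWord) : (𝓝[≠] ξ).NeBot := by
  refine Tendsto.neBot (f := fun n => Function.update ξ n (!ξ n)) (x := atTop)
    (tendsto_nhdsWithin_iff.2 ⟨tendsto_update_nhds ξ _, .of_forall fun n h => ?_⟩)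
  simpa using congrFun h n

theorem eventualStabilizer_eq_of_le {l : Filter BinaryWord} [l.NeBot] {ξ : BinaryWord}
    (hl : l ≤ 𝓝[≠] ξ) : eventualStabilizer 𝔽 l = eventualStabilizer 𝔽 (𝓝 ξ) := by
  ext g
  rw [mem_eventualStabilizer_iff, mem_eventualStabilizer_iff]
  refine ⟨fun hg => ?_, fun hg => hg.filter_mono (hl.trans nhdsWithin_le_nhds)⟩
  refine (eventually_smul_eq_or_ne g ξ).resolve_right fun hne => ?_
  obtain ⟨z, hz, hzne⟩ := (hg.and (hne.filter_mono hl)).exists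
  exact hzne hz

/-! ### Blocks -/

theorem const_eq_cons (a : Bool) : (fun _ => a : BinaryWord) = a ∷ fun _ => a := by
  funext i
  cases i <;> rfl

theorem blockWord_zero (a : Bool) (u : BinaryWord) : blockWord a 0 u = (!a) ∷ u := by
  funext i
  cases i <;> simp [blockWord]

theorem blockWord_succ (a : Bool) (n : ℕ) (u : BinaryWord) :
    blockWord a (n + 1) u = a ∷ blockWord a n u := by
  funext i
  cases i <;> simp [blockWord]

theorem eq_const_or_eq_blockWord (ξ : BinaryWord) :
    (∃ a, ξ = fun _ => a) ∨ ∃ a n u, 1 ≤ n ∧ ξ = blockWord a n u := by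
  by_cases h : ∃ m, ξ m ≠ ξ 0
  · refine .inr ⟨ξ 0, Nat.find h, drop (Nat.find h + 1) ξ, ?_, ?_⟩
    · exact Nat.one_le_iff_ne_zero.2 fun h0 => Nat.find_spec h (by rw [h0])
    · funext i
      rcases lt_trichotomy i (Nat.find h) with hi | rfl | hi
      · rw [blockWord, if_pos hi]
        exact not_not.1 (Nat.find_min h hi)
      · rw [blockWord, if_neg (lt_irrefl _), if_pos rfl, Bool.eq_not]
        exact Nat.find_spec h
      · rw [blockWord, if_neg hi.not_gt, if_neg hi.ne', drop]
        exact congrArg ξ (by omega)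
  · push Not at h
    exact .inl ⟨ξ 0, funext h⟩

/-- The points of the line of the grey vertex with label `10u`: an orbit of `x₀`. -/
def linePoint (j : ℤ) (u : BinaryWord) : BinaryWord :=
  FreeGroup.of (0 : Fin 2) ^ j • (true ∷ false ∷ u)

theorem linePoint_zero (u : BinaryWord) : linePoint 0 u = true ∷ false ∷ u := by
  rw [linePoint, zpow_zero, one_smul]

theorem zpow_succ_smul (k : ℤ) (u : BinaryWord) :
    FreeGroup.of (0 : Fin 2) • FreeGroup.of (0 : Fin 2) ^ k • u =
      FreeGroup.of (0 : Fin 2) ^ (k + 1) • u := by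
  rw [smul_smul, ← zpow_one_add, add_comm]

theorem zpow_smul_linePoint (i j : ℤ) (u : BinaryWord) :
    FreeGroup.of (0 : Fin 2) ^ i • linePoint j u = linePoint (i + j) u := by
  rw [linePoint, linePoint, smul_smul, zpow_add]

theorem of_zero_smul_linePoint (j : ℤ) (u : BinaryWord) :
    FreeGroup.of (0 : Fin 2) • linePoint j u = linePoint (j + 1) u := by
  rw [linePoint, linePoint, zpow_succ_smul]

theorem linePoint_succ (n : ℕ) (u : BinaryWord) :
    linePoint (n + 1) u = blockWord false (n + 1) u := by
  induction n with
  | zero =>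
    rw [blockWord_succ, blockWord_zero, ← of_zero_smul_linePoint, Nat.cast_zero, linePoint_zero,
      of_zero_smul_true_false, Bool.not_false]
  | succ n ih =>
    rw [Nat.cast_succ, ← of_zero_smul_linePoint, ih, blockWord_succ, blockWord_succ,
      blockWord_succ, of_zero_smul_false]

theorem linePoint_neg (n : ℕ) (u : BinaryWord) : linePoint (-n) u = blockWord true (n + 1) u := by
  induction n with
  | zero =>
    rw [blockWord_succ, blockWord_zero, Nat.cast_zero, neg_zero, linePoint_zero, Bool.not_true]
  | succ n ih =>
    rw [← smul_left_cancel_iff (FreeGroup.of (0 : Fin 2)), of_zero_smul_linePoint, Nat.cast_succ,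
      neg_add_rev, neg_add_cancel_comm, ih, blockWord_succ, blockWord_succ, blockWord_succ,
      of_zero_smul_true_true]

theorem linePoint_eq_blockWord (a : Bool) {n : ℕ} (hn : 1 ≤ n) (u : BinaryWord) :
    linePoint (if a = true then 1 - (n : ℤ) else n) u = blockWord a n u := by
  obtain ⟨n, rfl⟩ := Nat.exists_eq_add_of_le' hn
  cases a
  · simpa using linePoint_succ n u
  · simpa using linePoint_neg n u

theorem linePoint_injective2 : Function.Injective2 linePoint := by
  intro i j u v h
  have hshift : linePoint (i - j) u = linePoint 0 v := by
    rw [← smul_left_cancel_iff (FreeGroup.of (0 : Fin 2) ^ j), zpow_smul_linePoint,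
      zpow_smul_linePoint, add_sub_cancel, add_zero, h]
  rw [linePoint_zero] at hshift
  obtain hij | ⟨n, hn⟩ | ⟨n, hn⟩ : i - j = 0 ∨ (∃ n : ℕ, i - j = n + 1) ∨
      ∃ n : ℕ, i - j = -((n + 1 : ℕ) : ℤ) := by
    rcases lt_trichotomy (i - j) 0 with hneg | hzero | hpos
    · exact .inr (.inr ⟨(j - i - 1).toNat, by omega⟩)
    · exact .inl hzero
    · exact .inr (.inl ⟨(i - j - 1).toNat, by omega⟩)
  · rw [hij, linePoint_zero] at hshift
    exact ⟨sub_eq_zero.1 hij, (cons_injective2 (cons_injective2 hshift).2).2⟩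
  · rw [hn, linePoint_succ, blockWord_succ] at hshift
    exact absurd (congrFun hshift 0) Bool.false_ne_true
  · rw [hn, linePoint_neg, blockWord_succ, blockWord_succ] at hshift
    exact absurd (congrFun hshift 1).symm Bool.false_ne_true

theorem continuous_linePoint (j : ℤ) : Continuous (linePoint j) :=
  ((continuous_cons _).comp (continuous_cons _)).const_smul (FreeGroup.of (0 : Fin 2) ^ j)

theorem of_one_smul_linePoint (j : ℤ) (u : BinaryWord) :
    FreeGroup.of (1 : Fin 2) • linePoint j u =
      if 1 ≤ j then linePoint j u
      else if j = 0 then linePoint 0 (false ∷ u)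
      else if j = -1 then linePoint 0 (true ∷ u)
      else linePoint (j + 1) u := by
  split_ifs with hpos h0 h1
  · obtain ⟨n, rfl⟩ := Int.exists_add_of_le hpos
    rw [add_comm, linePoint_succ, blockWord_succ, of_one_smul_false]
  · rw [h0, linePoint_zero, linePoint_zero, of_one_smul_true, of_zero_smul_false]
  · rw [h1, show (-1 : ℤ) = -(1 : ℕ) from rfl, linePoint_neg, blockWord_succ, blockWord_succ,
      blockWord_zero, Bool.not_true, of_one_smul_true, of_zero_smul_true_false, linePoint_zero]
  · obtain ⟨n, rfl⟩ : ∃ n : ℕ, j = -((n + 2 : ℕ) : ℤ) := ⟨(-j - 2).toNat, by omega⟩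
    rw [← of_zero_smul_linePoint, linePoint_neg, blockWord_succ, blockWord_succ, blockWord_succ,
      of_one_smul_true, of_zero_smul_true_true, of_zero_smul_true_true]

theorem zpow_smul_ne {k : ℤ} (hk : k ≠ 0) {u : BinaryWord} (hu : ∀ a, u ≠ fun _ => a) :
    FreeGroup.of (0 : Fin 2) ^ k • u ≠ u := by
  obtain ⟨a, rfl⟩ | ⟨a, n, u, hn, rfl⟩ := eq_const_or_eq_blockWord u
  · exact (hu a rfl).elim
  · rw [← linePoint_eq_blockWord a hn, zpow_smul_linePoint]
    exact fun h => hk (by simpa using (linePoint_injective2 h).1)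

theorem zpow_smul_const (k : ℤ) (a : Bool) :
    FreeGroup.of (0 : Fin 2) ^ k • (fun _ => a : BinaryWord) = fun _ => a := by
  have h : FreeGroup.of (0 : Fin 2) ∈ stabilizer 𝔽 (fun _ => a : BinaryWord) := by
    rw [mem_stabilizer_iff, of_zero_smul]
    cases a
    · exact (const_eq_cons false).symm
    · rfl
  exact zpow_mem h k

theorem eventually_of_one_smul_const (a : Bool) : ∀ᶠ z in 𝓝 (fun _ => a : BinaryWord),
    FreeGroup.of (1 : Fin 2) • z = if a = false then z else FreeGroup.of (0 : Fin 2) • z := by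
  refine (eventually_forall_lt_apply_eq _ 3).mono fun z hz => ?_
  obtain ⟨b, z, rfl⟩ := exists_eq_cons z
  obtain ⟨c, z, rfl⟩ := exists_eq_cons z
  obtain ⟨d, z, rfl⟩ := exists_eq_cons z
  obtain ⟨rfl, rfl, rfl⟩ : b = a ∧ c = a ∧ d = a :=
    ⟨hz 0 (by omega), hz 1 (by omega), hz 2 (by omega)⟩
  cases d <;> simp

theorem eventually_ne_const (a : Bool) :
    ∀ᶠ z in 𝓝[≠] (fun _ => a : BinaryWord), ∀ b, z ≠ fun _ => b := by
  filter_upwards [(eventually_apply_eq _ 0).filter_mono nhdsWithin_le_nhds, self_mem_nhdsWithin]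
    with z hz hne b hb
  subst hb
  obtain rfl : b = a := hz
  exact hne rfl

end BinaryWord

/-! ### The limit graphs -/

open BinaryWord

theorem loops_lineGraph (a : Bool) :
    (lineGraph a).loops = eventualStabilizer 𝔽 (𝓝 (fun _ => a : BinaryWord)) := by
  let f (k : ℤ) : Germ (𝓝[≠] (fun _ => a : BinaryWord)) BinaryWord :=
    ((FreeGroup.of (0 : Fin 2) ^ k • · : BinaryWord → BinaryWord) : Germ _ _)
  have hstep (s : Fin 2) (k : ℤ) :
      FreeGroup.of s • f k = f (if s = 1 ∧ a = false then k else k + 1) := by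
    refine Germ.coe_eq.2 ?_
    obtain rfl | rfl : s = 0 ∨ s = 1 := by omega
    · exact .of_forall fun z => zpow_succ_smul k z
    · have htendsto := (continuous_const_smul (FreeGroup.of (0 : Fin 2) ^ k)).tendsto
        (fun _ => a : BinaryWord)
      rw [zpow_smul_const] at htendsto
      filter_upwards [(htendsto.mono_left nhdsWithin_le_nhds).eventually
        (eventually_of_one_smul_const a)] with z hz
      refine (hz : FreeGroup.of (1 : Fin 2) • _ = _).trans ?_
      cases a
      · rfl
      · exact zpow_succ_smul k z
  have hbase (k : ℤ) (hk : f k = f 0) : k = 0 := by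
    obtain ⟨z, hz, hne⟩ := ((Germ.coe_eq.1 hk).and (eventually_ne_const a)).exists
    by_contra hk0
    exact zpow_smul_ne hk0 hne (by simpa using hz)
  rw [(lineGraph a).loops_eq_stabilizer (f := f) (fun s k m h => h ▸ hstep s k) hbase]
  refine (stabilizer_coe_germ _ _).trans (eventualStabilizer_eq_of_le ?_)
  simp [lineGraph]

/-- The word `u` such that a grey vertex has the label `10u` when the grey vertex `s₀` has the
label `10y`, so that `s_k` is labeled by `10` followed by `y` without its first `k` letters. -/
def Grey.label : Grey → BinaryWord → BinaryWord
  | below v, y => v.foldr cons y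
  | above k, y => drop (k + 1) y
  | side k v, y => v.foldr cons ((!y k) ∷ drop (k + 1) y)

theorem drop_length_foldr_cons (v : List Bool) (y : BinaryWord) :
    drop v.length (v.foldr cons y) = y := by
  induction v with
  | nil => exact drop_zero y
  | cons a v ih => rw [List.foldr_cons, List.length_cons, drop_succ_cons, ih]

theorem Grey.eventually_label_child (w : BinaryWord) (a : Bool) (g : Grey) :
    ∀ᶠ y in 𝓝 w, (g.child w a).label y = a ∷ g.label y := by
  rcases g with v | k | ⟨k, v⟩
  · exact .of_forall fun y => rfl
  · filter_upwards [eventually_apply_eq w k] with y hy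
    rw [child]
    split_ifs with ha
    · rw [ha, ← hy, label, cons_drop_succ]
      cases k
      · exact (drop_zero y).symm
      · rfl
    · rw [Bool.eq_not.2 ha, ← hy]
      rfl
  · exact .of_forall fun y => rfl

theorem Grey.eventually_label_ne (w : BinaryWord) {g : Grey} (hg : g ≠ below []) :
    ∀ᶠ y in 𝓝[≠] w, g.label y ≠ y := by
  rcases g with v | k | ⟨k, v⟩
  · have hv : v.length ≠ 0 := fun h => hg (by rw [List.length_eq_zero_iff.1 h])
    refine (eventually_drop_ne_drop w hv).mono fun y hy h => hy ?_
    nth_rw 1 [← h, label, drop_length_foldr_cons, drop_zero]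
  · refine (eventually_drop_ne_drop w k.succ_ne_zero).mono fun y hy h => hy ?_
    rw [drop_zero]
    exact h
  · have htail {y : BinaryWord} (h : (side k v).label y = y) :
        drop v.length y = (!y k) ∷ drop (k + 1) y := by
      nth_rw 1 [← h, label, drop_length_foldr_cons]
    obtain rfl | hne := eq_or_ne v.length k
    · refine .of_forall fun y h => Bool.not_ne_self _ (congrFun (htail h) 0).symm
    · refine (eventually_drop_ne_drop w (Nat.succ_ne_succ_iff.2 hne)).mono fun y hy h => hy ?_
      rw [Nat.succ_eq_add_one, ← drop_drop, htail h, drop_succ_cons, drop_zero]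

theorem eventually_of_smul_linePoint_label (w : BinaryWord) (s : Fin 2) (p : Grey × ℤ) :
    ∀ᶠ y in 𝓝 w, FreeGroup.of s • linePoint p.2 (p.1.label y) =
      linePoint (limitStep w s p).2 ((limitStep w s p).1.label y) := by
  obtain rfl | rfl : s = 0 ∨ s = 1 := by omega
  · exact .of_forall fun y => of_zero_smul_linePoint _ _
  · filter_upwards [p.1.eventually_label_child w false, p.1.eventually_label_child w true]
      with y hfalse htrue
    rw [of_one_smul_linePoint, limitStep, ← hfalse, ← htrue]
    split_ifs <;> rfl

theorem loops_upwardGraph (w : BinaryWord) (j : ℤ) :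
    (upwardGraph w j).loops = eventualStabilizer 𝔽 (𝓝 (linePoint j w)) := by
  let f (p : Grey × ℤ) : Germ (𝓝[≠] w) BinaryWord :=
    ((fun y => linePoint p.2 (p.1.label y) : BinaryWord → BinaryWord) : Germ _ _)
  have hstep (s : Fin 2) (p : Grey × ℤ) : FreeGroup.of s • f p = f (limitStep w s p) :=
    Germ.coe_eq.2 ((eventually_of_smul_linePoint_label w s p).filter_mono nhdsWithin_le_nhds)
  have hbase (p : Grey × ℤ) (hp : f p = f (.spine 0, j)) : p = (.spine 0, j) := by
    have hp := (Germ.coe_eq.1 hp).mono fun y hy => linePoint_injective2 hy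
    refine Prod.ext ?_ hp.exists.choose_spec.1
    by_contra hne
    obtain ⟨y, hy, hne⟩ := (hp.and (Grey.eventually_label_ne w hne)).exists
    exact hne hy.2
  rw [(upwardGraph w j).loops_eq_stabilizer (f := f) (fun s p q h => h ▸ hstep s p) hbase]
  refine (stabilizer_coe_germ _ _).trans (eventualStabilizer_eq_of_le ?_)
  exact (continuous_linePoint j).continuousWithinAt.tendsto_nhdsWithin fun y hy h =>
    hy (linePoint_injective2 h).2

theorem loops_limitGraph (ξ : BinaryWord) :
    (limitGraph ξ).loops = eventualStabilizer 𝔽 (𝓝 ξ) := by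
  obtain ⟨a, rfl⟩ | ⟨a, n, u, hn, rfl⟩ := eq_const_or_eq_blockWord ξ
  · rw [limitGraph_const, loops_lineGraph]
  · rw [limitGraph_blockWord a n hn, loops_upwardGraph, linePoint_eq_blockWord a hn]

/-! ### Binary expansions -/

theorem digits_add_div_zero {b : ℕ} [NeZero b] (a : Fin b) {t : ℝ} (ht : t ∈ Ico 0 1) :
    ((a + t) / b).digits b 0 = a := by
  rw [Real.digits, zero_add, pow_one, div_mul_cancel₀ _ (NeZero.ne _), add_comm,
    Nat.floor_add_natCast ht.1, Nat.floor_eq_zero.2 ht.2, zero_add, Fin.ofNat_val_eq_self]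

theorem digits_add_div_succ {b : ℕ} [NeZero b] (a : Fin b) {t : ℝ} (ht : 0 ≤ t) (i : ℕ) :
    ((a + t) / b).digits b (i + 1) = t.digits b i := by
  have hshift : ((a + t) / b) * (b : ℝ) ^ (i + 1 + 1) = t * b ^ (i + 1) + (a * b ^ i * b : ℕ) := by
    rw [add_comm (a : ℝ), pow_succ' _ (i + 1), ← mul_assoc, div_mul_cancel₀ _ (NeZero.ne _)]
    push_cast
    ring
  rw [Real.digits, Real.digits, hshift, Nat.floor_add_natCast (by positivity), Fin.ext_iff,
    Fin.val_ofNat, Fin.val_ofNat, Nat.add_mul_mod_self_right]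

namespace BinaryWord

/-- The binary expansion of a number `t ∈ [0,1)` that does not end with infinitely many letters
`1`. -/
noncomputable def ofReal (t : ℝ) : BinaryWord := fun i => finTwoEquiv (t.digits 2 i)

theorem injOn_ofReal : InjOn ofReal (Ico 0 1) := by
  intro s hs t ht h
  have hdigits : s.digits 2 = t.digits 2 := finTwoEquiv.injective.comp_left h
  rw [← Real.ofDigits_digits one_lt_two hs, hdigits, Real.ofDigits_digits one_lt_two ht]

theorem ofReal_add_div_two (a : Bool) {t : ℝ} (ht : t ∈ Ico 0 1) :
    ofReal ((a.toNat + t) / 2) = a ∷ ofReal t := by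
  have ha : a.toNat = (finTwoEquiv.symm a : ℕ) := by cases a <;> rfl
  funext i
  rw [ha, ofReal, ← Nat.cast_ofNat (R := ℝ)]
  cases i with
  | zero => rw [digits_add_div_zero _ ht, Equiv.apply_symm_apply, cons_zero]
  | succ i => rw [digits_add_div_succ _ ht.1, cons_succ, ofReal]

theorem ofReal_half {t : ℝ} (ht : t ∈ Ico 0 1) : ofReal (t / 2) = false ∷ ofReal t := by
  simpa using ofReal_add_div_two false ht

theorem ofReal_one_add_half {t : ℝ} (ht : t ∈ Ico 0 1) :
    ofReal ((1 + t) / 2) = true ∷ ofReal t := by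
  simpa using ofReal_add_div_two true ht

theorem exists_eq_half {t : ℝ} (ht : t ∈ Ico 0 1) :
    (∃ s ∈ Ico (0 : ℝ) 1, t = s / 2) ∨ ∃ s ∈ Ico (0 : ℝ) 1, t = (1 + s) / 2 := by
  rcases lt_or_ge t (1 / 2) with h | h
  · exact .inl ⟨2 * t, ⟨by linarith [ht.1], by linarith⟩, by ring⟩
  · exact .inr ⟨2 * t - 1, ⟨by linarith, by linarith [ht.2]⟩, by ring⟩

theorem ofReal_x0Fun {t : ℝ} (ht : t ∈ Ico 0 1) :
    ofReal (x0Fun t) = FreeGroup.of (0 : Fin 2) • ofReal t := by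
  obtain ⟨s, hs, rfl⟩ | ⟨s, hs, rfl⟩ := exists_eq_half ht
  · have hx : x0Fun (s / 2) = s / 2 / 2 := by
      rw [x0Fun, if_pos (by linarith [hs.2])]
    rw [hx, ofReal_half ⟨by linarith [hs.1], by linarith [hs.2]⟩, ofReal_half hs,
      of_zero_smul_false]
  obtain ⟨r, hr, rfl⟩ | ⟨r, hr, rfl⟩ := exists_eq_half hs
  · have hx : x0Fun ((1 + r / 2) / 2) = (1 + r) / 2 / 2 := by
      rw [x0Fun]
      split_ifs <;> linarith [hr.1, hr.2]
    rw [hx, ofReal_half ⟨by linarith [hr.1], by linarith [hr.2]⟩, ofReal_one_add_half hr,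
      ofReal_one_add_half hs, ofReal_half hr, of_zero_smul_true_false]
  · have hx : x0Fun ((1 + (1 + r) / 2) / 2) = (1 + r) / 2 := by
      rw [x0Fun]
      split_ifs <;> linarith [hr.1, hr.2]
    rw [hx, ofReal_one_add_half hs, ofReal_one_add_half hr, of_zero_smul_true_true]

theorem ofReal_x1Fun {t : ℝ} (ht : t ∈ Ico 0 1) :
    ofReal (x1Fun t) = FreeGroup.of (1 : Fin 2) • ofReal t := by
  obtain ⟨s, hs, rfl⟩ | ⟨s, hs, rfl⟩ := exists_eq_half ht
  · have hx : x1Fun (s / 2) = s / 2 := by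
      rw [x1Fun, if_pos (by linarith [hs.2])]
    rw [hx, ofReal_half hs, of_one_smul_false]
  · have hx : x1Fun ((1 + s) / 2) = (1 + x0Fun s) / 2 := by
      rw [x0Fun, x1Fun]
      split_ifs <;> linarith [hs.1, hs.2]
    have hx0 : x0Fun s ∈ Ico 0 1 := by
      rw [x0Fun]
      split_ifs <;> constructor <;> linarith [hs.1, hs.2]
    rw [hx, ofReal_one_add_half hx0, ofReal_x0Fun hs, ofReal_one_add_half hs, of_one_smul_true]

theorem ofReal_gen_smul (s : Fin 2) {t : I} (ht : t < 1) :
    ofReal (gen s • t : I) = FreeGroup.of s • ofReal t := by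
  obtain rfl | rfl : s = 0 ∨ s = 1 := by omega
  · rw [gen_zero_smul, ofReal_x0Fun ⟨t.2.1, ht⟩]
  · rw [gen_one_smul, ofReal_x1Fun ⟨t.2.1, ht⟩]

end BinaryWord

/-! ### Schreier graphs of dyadic rationals -/

namespace DyadicPoint

/-- The binary expansion with finitely many letters `1` of a dyadic rational. -/
noncomputable def word (q : DyadicPoint) : BinaryWord := ofReal q.1

theorem exists_word_eq_cons (a : Bool) (q : DyadicPoint) :
    ∃ r : DyadicPoint, r.word = cons a q.word := by
  obtain ⟨⟨k, n, hk⟩, h0, h1⟩ := q.2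
  have ha : (a.toNat : ℝ) ≤ 1 := mod_cast a.toNat_le
  refine ⟨⟨⟨(a.toNat + q.1) / 2, by positivity, by linarith⟩,
    ⟨a.toNat * 2 ^ n + k, n + 1, ?_⟩, by positivity, by linarith⟩,
    ofReal_add_div_two a ⟨h0.le, h1⟩⟩
  push_cast
  rw [hk, pow_succ]
  field_simp

theorem exists_word_forall_lt_eq (ξ : BinaryWord) (n : ℕ) :
    ∃ q : DyadicPoint, ∀ i < n, q.word i = ξ i := by
  induction n generalizing ξ with
  | zero => exact ⟨half, by simp⟩
  | succ n ih =>
    obtain ⟨a, ξ, rfl⟩ := exists_eq_cons ξ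
    obtain ⟨q, hq⟩ := ih ξ
    obtain ⟨r, hr⟩ := q.exists_word_eq_cons a
    refine ⟨r, fun i hi => ?_⟩
    rw [hr]
    cases i with
    | zero => rfl
    | succ i => exact hq i (by omega)

theorem denseRange_word : DenseRange word := by
  intro ξ
  choose q hq using exists_word_forall_lt_eq ξ
  refine mem_closure_of_tendsto (b := atTop) (tendsto_pi_nhds.2 fun i => ?_)
    (.of_forall fun n => mem_range_self (q n))
  exact tendsto_nhds_of_eventually_eq ((eventually_gt_atTop i).mono fun n hn => hq n i hn)

instance (ξ : BinaryWord) : (comap word (𝓝[≠] ξ)).NeBot := by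
  refine comap_neBot_iff.2 fun t ht => ?_
  obtain ⟨_, ⟨⟨q, rfl⟩, hne⟩, hq⟩ :=
    (denseRange_word.sdiff_singleton ξ).inter_nhds_nonempty (insert_mem_nhds_iff.2 ht)
  exact ⟨q, hq.resolve_left hne⟩

end DyadicPoint

theorem loops_schreierGraph_rebase {q r : DyadicPoint} (v : (schreierGraph q).V) (h : v.1 = r.1) :
    ((schreierGraph q).rebase v).loops = stabilizer 𝔽 r.word := by
  have hlt (x : (schreierGraph q).V) : x.1 < 1 := by
    obtain ⟨_, f, rfl⟩ := x
    exact (q.map f).2.2.2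
  rw [PGraph.loops_eq_stabilizer (Γ := (schreierGraph q).rebase v)
    (f := fun x : (schreierGraph q).V => ofReal x.1)]
  · exact congrArg (fun t : I => stabilizer 𝔽 (ofReal t)) h
  · exact fun s x y hE => (ofReal_gen_smul s (hlt x)).symm.trans
      (congrArg (fun z : (schreierGraph q).V => ofReal z.1) hE)
  · exact fun x hx => Subtype.ext (Subtype.ext
      (injOn_ofReal ⟨x.1.2.1, hlt x⟩ ⟨v.1.2.1, hlt v⟩ hx))

theorem loops_schreierGraph (q : DyadicPoint) : (schreierGraph q).loops = stabilizer 𝔽 q.word :=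
  loops_schreierGraph_rebase (schreierGraph q).base rfl

theorem exists_iso_rebase_schreierGraph_iff (q : DyadicPoint) {Γ : PGraph} :
    (∃ v, Γ.Iso ((schreierGraph q).rebase v)) ↔
      ∃ r : DyadicPoint, Γ.loops = stabilizer 𝔽 r.word := by
  simp only [PGraph.iso_iff_loops_eq]
  constructor
  · rintro ⟨⟨_, f, rfl⟩, h⟩
    exact ⟨q.map f, h.trans (loops_schreierGraph_rebase (r := q.map f) _ rfl)⟩
  · rintro ⟨r, h⟩
    obtain ⟨g, -, hg⟩ := q.exists_smul_eq r
    exact ⟨⟨r.1, g, hg⟩, h.trans (loops_schreierGraph_rebase _ rfl).symm⟩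

/-! ### The closure -/

theorem loops_eq_eventualStabilizer_of_tendsto {l : Filter DyadicPoint} [l.NeBot] {Γ : PGraph}
    (h : Tendsto schreierGraph l (𝓝 Γ)) :
    Γ.loops = eventualStabilizer 𝔽 (map DyadicPoint.word l) := by
  ext g
  have hg := PGraph.tendsto_nhds_iff.1 h g
  simp only [loops_schreierGraph, mem_stabilizer_iff] at hg
  rw [mem_eventualStabilizer_iff, eventually_map, eventually_congr hg, eventually_const]

theorem tendsto_schreierGraph_comap_word {Γ : PGraph} {ξ : BinaryWord}
    (h : Γ.loops = eventualStabilizer 𝔽 (𝓝 ξ)) :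
    Tendsto schreierGraph (comap DyadicPoint.word (𝓝[≠] ξ)) (𝓝 Γ) := by
  refine PGraph.tendsto_nhds_iff.2 fun g => ?_
  simp only [h, loops_schreierGraph, mem_stabilizer_iff, mem_eventualStabilizer_iff]
  refine tendsto_comap.eventually (p := fun z => g • z = z ↔ ∀ᶠ y in 𝓝 ξ, g • y = y) ?_
  obtain hfix | hne := eventually_smul_eq_or_ne g ξ
  · exact (hfix.filter_mono nhdsWithin_le_nhds).mono fun z hz => iff_of_true hz hfix
  · refine hne.mono fun z hz => iff_of_false hz fun hfix => ?_
    obtain ⟨y, hy, hy'⟩ := (hne.and (hfix.filter_mono nhdsWithin_le_nhds)).exists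
    exact hy hy'

theorem mem_closure_dyadicFamily_iff {Γ : PGraph} : Γ ∈ closure dyadicFamily ↔
    (∃ q : DyadicPoint, Γ.loops = stabilizer 𝔽 q.word) ∨
      ∃ ξ : BinaryWord, Γ.loops = eventualStabilizer 𝔽 (𝓝 ξ) := by
  constructor
  · intro h
    rw [dyadicFamily, mem_closure_iff_clusterPt, ← image_univ, ← map_principal] at h
    obtain ⟨U, -, hU⟩ := mapClusterPt_iff_ultrafilter.1 h
    rw [loops_eq_eventualStabilizer_of_tendsto hU]
    obtain ⟨ξ, -, hξ⟩ := isCompact_univ.ultrafilter_le_nhds (U.map DyadicPoint.word) (by simp)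
    obtain hpure | hne := (U.map DyadicPoint.word).em (· = ξ)
    · left
      obtain ⟨q, rfl⟩ := (eventually_map.1 hpure).exists
      have hmap : map DyadicPoint.word U = pure q.word :=
        (NeBot.le_pure_iff inferInstance).1 (le_pure_iff.2 hpure)
      exact ⟨q, by rw [hmap, eventualStabilizer_pure]⟩
    · exact .inr ⟨ξ, eventualStabilizer_eq_of_le (le_inf hξ (le_principal_iff.2 hne))⟩
  · rintro (⟨q, hq⟩ | ⟨ξ, hξ⟩)
    · refine mem_closure_of_tendsto (f := schreierGraph) (b := pure q) ?_
        (.of_forall mem_range_self)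
      exact PGraph.tendsto_nhds_iff.2 fun g => by simp [hq, loops_schreierGraph]
    · exact mem_closure_of_tendsto (tendsto_schreierGraph_comap_word hξ)
        (.of_forall mem_range_self)

theorem exists_loops_eq_eventualStabilizer_iff {Γ : PGraph} :
    (∃ ξ : BinaryWord, Γ.loops = eventualStabilizer 𝔽 (𝓝 ξ)) ↔
      (∃ (n : ℕ) (w : ℕ → Bool), 1 ≤ n ∧
        (Γ.Iso (limitGraph (blockWord true n w)) ∨ Γ.Iso (limitGraph (blockWord false n w)))) ∨
      Γ.Iso (lineGraph false) ∨ Γ.Iso (lineGraph true) := by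
  simp only [← loops_limitGraph, ← PGraph.iso_iff_loops_eq, ← limitGraph_const]
  constructor
  · rintro ⟨ξ, h⟩
    obtain ⟨_ | _, rfl⟩ | ⟨_ | _, n, w, hn, rfl⟩ := eq_const_or_eq_blockWord ξ
    · exact .inr (.inl h)
    · exact .inr (.inr h)
    · exact .inl ⟨n, w, hn, .inr h⟩
    · exact .inl ⟨n, w, hn, .inl h⟩
  · rintro (⟨n, w, -, h | h⟩ | h | h)
    all_goals exact ⟨_, h⟩

/-! ### Separating the limit graphs -/

namespace BinaryWord

theorem map_smul_nhds (g : 𝔽) (ξ : BinaryWord) : map (g • ·) (𝓝 ξ) = 𝓝 (g • ξ) :=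
  (Homeomorph.smul g).map_nhds_eq ξ

theorem of_one_mem_eventualStabilizer_iff {ξ : BinaryWord} :
    FreeGroup.of 1 ∈ eventualStabilizer 𝔽 (𝓝 ξ) ↔ ξ 0 = false := by
  rw [mem_eventualStabilizer_iff]
  constructor
  · intro hfix
    by_contra hξ
    obtain ⟨z, ⟨hz, hz0⟩, hne⟩ := (((hfix.and (eventually_apply_eq ξ 0)).filter_mono
      nhdsWithin_le_nhds).and (eventually_drop_ne_drop ξ (show 1 ≠ 2 by decide))).exists
    obtain ⟨a, z, rfl⟩ := exists_eq_cons z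
    obtain rfl : a = true := hz0.trans (Bool.eq_true_of_not_eq_false hξ)
    rw [of_one_smul_true] at hz
    refine zpow_smul_ne one_ne_zero (fun b hb => hne ?_)
      ((zpow_one (FreeGroup.of (0 : Fin 2))).symm ▸ (cons_injective2 hz).2)
    rw [hb, drop_succ_cons, drop_succ_cons]
    rfl
  · intro hξ
    filter_upwards [eventually_apply_eq ξ 0] with z hz
    obtain ⟨a, z, rfl⟩ := exists_eq_cons z
    obtain rfl : a = false := hz.trans hξ
    exact of_one_smul_false z

/-- The prefixes `0`, `1` and `10`, as maps on infinite words: up to the action they replace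
every nonempty prefix. -/
def stems : Set (BinaryWord → BinaryWord) := {cons false, cons true, fun u => true ∷ false ∷ u}

theorem exists_smul_stem_cons_eq {f : BinaryWord → BinaryWord} (hf : f ∈ stems) (a : Bool) :
    ∃ g : 𝔽, ∃ f' ∈ stems, ∀ u, g • f (a ∷ u) = f' u := by
  obtain rfl | rfl | rfl := hf <;> cases a
  · exact ⟨(.of 0)⁻¹, cons false, by simp [stems], of_zero_inv_smul_false_false⟩
  · exact ⟨(.of 0)⁻¹, fun u => true ∷ false ∷ u, by simp [stems], of_zero_inv_smul_false_true⟩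
  · exact ⟨1, fun u => true ∷ false ∷ u, by simp [stems], fun u => one_smul _ _⟩
  · exact ⟨.of 0, cons true, by simp [stems], of_zero_smul_true_true⟩
  · refine ⟨(.of 1)⁻¹, fun u => true ∷ false ∷ u, by simp [stems], fun u => ?_⟩
    rw [of_one_inv_smul_true, of_zero_inv_smul_false_false]
  · refine ⟨.of 0 * (.of 1)⁻¹, fun u => true ∷ false ∷ u, by simp [stems], fun u => ?_⟩
    rw [mul_smul, of_one_inv_smul_true, of_zero_inv_smul_false_true, of_zero_smul_true_true]

theorem exists_forall_smul_eq_stem (ξ : BinaryWord) (n : ℕ) :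
    ∃ g : 𝔽, ∃ f ∈ stems, ∀ u : BinaryWord, (∀ i ≤ n, u i = ξ i) → g • u = f (drop (n + 1) u) := by
  induction n with
  | zero =>
    refine ⟨1, cons (ξ 0), by cases ξ 0 <;> simp [stems], fun u hu => ?_⟩
    rw [one_smul, ← hu 0 le_rfl, cons_drop_succ, drop_zero]
  | succ n ih =>
    obtain ⟨g, f, hf, hg⟩ := ih
    obtain ⟨g', f', hf', hg'⟩ := exists_smul_stem_cons_eq hf (ξ (n + 1))
    refine ⟨g' * g, f', hf', fun u hu => ?_⟩
    rw [mul_smul, hg u fun i hi => hu i (by omega), ← cons_drop_succ, hu _ le_rfl, hg']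

theorem exists_smul_stem_apply_zero {f : BinaryWord → BinaryWord} (hf : f ∈ stems) :
    ∃ g : 𝔽, ∀ u, (g • f u) 0 = u 0 := by
  suffices ∃ g : 𝔽, ∀ a v, (g • f (a ∷ v)) 0 = a by
    obtain ⟨g, hg⟩ := this
    refine ⟨g, fun u => ?_⟩
    obtain ⟨a, v, rfl⟩ := exists_eq_cons u
    exact hg a v
  obtain rfl | rfl | rfl := hf
  · refine ⟨(.of 0)⁻¹, fun a v => ?_⟩
    cases a
    · rw [of_zero_inv_smul_false_false, cons_zero]
    · rw [of_zero_inv_smul_false_true, cons_zero]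
  · refine ⟨.of 0, fun a v => ?_⟩
    cases a
    · rw [of_zero_smul_true_false, cons_zero]
    · rw [of_zero_smul_true_true, cons_zero]
  · refine ⟨.of 0 * (.of 1)⁻¹, fun a v => ?_⟩
    rw [mul_smul, of_one_inv_smul_true]
    cases a
    · rw [of_zero_inv_smul_false_false, of_zero_smul_true_false, cons_zero]
    · rw [of_zero_inv_smul_false_true, of_zero_smul_true_true, cons_zero]

theorem eq_of_forall_smul_apply_zero_eq {ξ η : BinaryWord}
    (h : ∀ g : 𝔽, (g • ξ) 0 = (g • η) 0) : ξ = η := by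
  funext n
  induction n using Nat.strong_induction_on with
  | h n ih =>
    cases n with
    | zero => simpa using h 1
    | succ n =>
      obtain ⟨g, f, hf, hg⟩ := exists_forall_smul_eq_stem ξ n
      obtain ⟨g', hg'⟩ := exists_smul_stem_apply_zero hf
      have hhead {u : BinaryWord} (hu : ∀ i ≤ n, u i = ξ i) : ((g' * g) • u) 0 = u (n + 1) := by
        rw [mul_smul, hg u hu, hg', drop, add_zero]
      rw [← hhead fun i _ => rfl, h, hhead fun i hi => (ih i (by omega)).symm]

theorem injective_eventualStabilizer_nhds :
    Function.Injective fun ξ : BinaryWord => eventualStabilizer 𝔽 (𝓝 ξ) := by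
  refine fun ξ η h => eq_of_forall_smul_apply_zero_eq fun g => Bool.eq_iff_iff.2 (not_iff_not.1 ?_)
  have hconj (ζ : BinaryWord) :
      g⁻¹ * .of 1 * g ∈ eventualStabilizer 𝔽 (𝓝 ζ) ↔ ¬(g • ζ) 0 = true := by
    rw [conj_mem_eventualStabilizer_iff, map_smul_nhds, of_one_mem_eventualStabilizer_iff,
      Bool.not_eq_true]
  rw [← hconj, ← hconj]
  exact SetLike.ext_iff.1 h _

end BinaryWord

end ThompsonSchreier

theorem mainTheorem5 :
    (∀ Γ : ThompsonSchreier.PGraph, Γ ∈ closure ThompsonSchreier.dyadicFamily ↔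
      (∃ v : (ThompsonSchreier.schreierGraph ThompsonSchreier.DyadicPoint.half).V,
        Γ.Iso ((ThompsonSchreier.schreierGraph ThompsonSchreier.DyadicPoint.half).rebase v)) ∨
      (∃ (n : ℕ) (w : ℕ → Bool), 1 ≤ n ∧
        (Γ.Iso (ThompsonSchreier.limitGraph (ThompsonSchreier.blockWord true n w)) ∨
          Γ.Iso (ThompsonSchreier.limitGraph (ThompsonSchreier.blockWord false n w)))) ∨
      (Γ.Iso (ThompsonSchreier.lineGraph false) ∨ Γ.Iso (ThompsonSchreier.lineGraph true))) ∧
    (∀ ξ η : ℕ → Bool,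
      (ThompsonSchreier.limitGraph ξ).Iso (ThompsonSchreier.limitGraph η) → ξ = η) := by
  refine ⟨fun Γ => ?_, fun ξ η h => ?_⟩
  · rw [ThompsonSchreier.mem_closure_dyadicFamily_iff,
      ThompsonSchreier.exists_iso_rebase_schreierGraph_iff,
      ThompsonSchreier.exists_loops_eq_eventualStabilizer_iff]
  · have hloops := h.loops_eq
    rw [ThompsonSchreier.loops_limitGraph, ThompsonSchreier.loops_limitGraph] at hloops
    exact ThompsonSchreier.BinaryWord.injective_eventualStabilizer_nhds hloops
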